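/- Let $H$ be an infinite-dimensional separable complex Hilbert space and let $A$ be a self-adjoint, coercive operator in $H$ with compact resolvent and simple spectrum. Let $a>0$, $\alpha\in\mathbb{R}\setminus\{0\}$ and $\gamma\in\mathbb{R}$, and assume that either $a=1$ and $\gamma<0$, or $a\neq 1$ and $\gamma\le 0$. Consider the system $$u_{tt}+aAu+A^{\gamma}u_t+\alpha y_t=0,\qquad y_{tt}+Ay-\alpha u_t=0 .$$ Let $\mathcal H=D(A^{1/2})\times H\times D(A^{1/2})\times H$ with the norm $$\|(u,v,y,z)\|_{\mathcal H}^2=a\|A^{1/2}u\|^2+\|A^{1/2}y\|^2+\|v\|^2+\|z\|^2 ,$$ and let $$\mathcal A(u,v,y,z)=(v,\,-aAu-A^{\gamma}v-\alpha z,\;z,\,-Ay+\alpha v),$$ $$D(\mathcal A)=\{(u,v,y,z)\in\mathcal H:\ u,y\in D(A),\ v,z\in D(A^{1/2})\}.$$ Then $\mathcal A$ generates a $C_0$-semigroup of contractions $(e^{t\mathcal A})_{t\ge 0}$ on $\mathcal H$. Write $E(t)=\tfrac12\|e^{t\mathcal A}u_0\|_{\mathcal H}^2$ for the energy of the solution with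 initial state $u_0$, and put $$\delta(\gamma)=\begin{cases}-\dfrac1\gamma,& a=1,\ \gamma<0,\\[2mm] \dfrac{1}{1-\gamma},& a\neq 1,\ \gamma\le 0.\end{cases}$$ There is a constant $C>0$ such that for every $u_0\in D(\mathcal A)$ $$E(t)\le \frac{C}{t^{\delta(\gamma)}}\,\|\mathcal A u_0\|_{\mathcal H}^2\qquad\text{for all } t>0 .$$ Moreover this rate is optimal: for every $\varepsilon>0$ there is no constant $C>0$ such that $E(t)\le C\,t^{-(\delta(\gamma)+\varepsilon)}\|\mathcal A u_0\|_{\mathcal H}^2$ for all $u_0\in D(\mathcal A)$ and all $t>0$. -/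

import Mathlib

open Filter Topology

noncomputable section

namespace CoupledSystem

/-! ### The operator `A` and its fractional powers -/

section Operator

variable {H : Type*} [NormedAddCommGroup H] [InnerProductSpace ℂ H]

/-- `ker (A - l)`, as a subspace of `H`. -/
def eigenspace (A : H →ₗ.[ℂ] H) (l : ℂ) : Submodule ℂ H where
  carrier := {u | ∃ h : u ∈ A.domain, A ⟨u, h⟩ = l • u}
  zero_mem' := ⟨A.domain.zero_mem, by
    rw [smul_zero]
    exact A.map_zero⟩
  add_mem' := by
    rintro u v ⟨hu, hu'⟩ ⟨hv, hv'⟩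
    refine ⟨A.domain.add_mem hu hv, ?_⟩
    have := A.map_add ⟨u, hu⟩ ⟨v, hv⟩
    rw [hu', hv', ← smul_add] at this
    exact this
  smul_mem' := by
    rintro c u ⟨hu, hu'⟩
    refine ⟨A.domain.smul_mem c hu, ?_⟩
    have := A.map_smul c ⟨u, hu⟩
    rw [hu', smul_comm] at this
    exact this

/-- `⟨A u, u⟩ ≥ c ‖u‖²` on `D(A)` for some `c > 0`. -/
def IsCoercive (A : H →ₗ.[ℂ] H) : Prop :=
  ∃ c : ℝ, 0 < c ∧ ∀ u : A.domain, c * ‖(u : H)‖ ^ 2 ≤ (inner ℂ (A u) (u : H)).re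

/-- For some complex number `l`, the operator `A - l` has an everywhere defined, bounded and
compact inverse `R`. -/
def HasCompactResolvent (A : H →ₗ.[ℂ] H) : Prop :=
  ∃ (l : ℂ) (R : H →L[ℂ] H), IsCompactOperator R ∧
    (∀ f : H, ∃ h : R f ∈ A.domain, A ⟨R f, h⟩ - l • R f = f) ∧
    (∀ u : A.domain, R (A u - l • (u : H)) = u)

/-- All eigenvalues are simple. (For a self-adjoint operator with compact resolvent the spectrum
consists of eigenvalues, and geometric and algebraic multiplicities agree.) -/
def HasSimpleSpectrum (A : H →ₗ.[ℂ] H) : Prop :=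
  ∀ l : ℂ, Module.rank ℂ (eigenspace A l) ≤ 1

variable [CompleteSpace H]

/-- The orthogonal projection of `H` onto `ker (A - l)` (which is closed when `A` is
self-adjoint, so that the closure changes nothing). -/
def spectralProj (A : H →ₗ.[ℂ] H) (l : ℝ) : H →L[ℂ] H :=
  (eigenspace A (l : ℂ)).topologicalClosure.starProjection

/-- The power `A ^ s` of a positive self-adjoint operator `A` with compact resolvent, through its
spectral decomposition: `A ^ s u = ∑ l ^ s P_l u`, where `P_l` is the orthogonal projection onto
`ker (A - l)` (zero unless `l` is an eigenvalue), with domain the set of all `u` for which the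
series converges in `H`. The terms are pairwise orthogonal, so that this amounts to
`∑ l ^ (2 s) ‖P_l u‖² < ∞`. -/
def fracPow (A : H →ₗ.[ℂ] H) (s : ℝ) : H →ₗ.[ℂ] H where
  domain :=
    { carrier := {u | Summable fun l : ℝ => ((l ^ s : ℝ) : ℂ) • spectralProj A l u}
      zero_mem' := by simp
      add_mem' := by
        intro u v hu hv
        simpa [smul_add] using Summable.add hu hv
      smul_mem' := by
        intro c u hu
        simpa [smul_comm c] using Summable.const_smul c hu }
  toFun :=
    { toFun := fun u => ∑' l : ℝ, ((l ^ s : ℝ) : ℂ) • spectralProj A l (u : H)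
      map_add' := by
        intro u v
        rw [← Summable.tsum_add u.2 v.2]
        simp [smul_add]
      map_smul' := by
        intro c u
        rw [RingHom.id_apply, ← Summable.tsum_const_smul c u.2]
        simp [smul_comm c] }

/-- For `γ ≤ 0`, the power `A ^ γ` is defined on all of `H`. -/
theorem fracPow_domain_eq_top {A : H →ₗ.[ℂ] H} (hA : IsSelfAdjoint A) (hc : IsCoercive A)
    {γ : ℝ} (hγ : γ ≤ 0) : (fracPow A γ).domain = ⊤ := by
  obtain ⟨c, hc0, hc⟩ := hc
  have hsymm : ∀ x y : A.domain, inner ℂ (A x) (y : H) = inner ℂ (x : H) (A y) := by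
    have h := A.adjoint_isFormalAdjoint hA.dense_domain
    rw [LinearPMap.isSelfAdjoint_def.mp hA] at h
    exact h
  have hpos : ∀ (l : ℝ) (u : H), u ∈ eigenspace A l → u = 0 ∨ c ≤ l := by
    rintro l u ⟨hu, hu'⟩
    by_cases h0 : u = 0
    · exact Or.inl h0
    · right
      have h := hc ⟨u, hu⟩
      rw [hu', inner_smul_left, inner_self_eq_norm_sq_to_K] at h
      have hn : 0 < ‖u‖ ^ 2 := by positivity
      have h' : c * ‖u‖ ^ 2 ≤ l * ‖u‖ ^ 2 := by
        simpa [← Complex.ofReal_pow, ← Complex.ofReal_mul] using h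
      exact le_of_mul_le_mul_right h' hn
  let V : ℝ → Submodule ℂ H := fun l => (eigenspace A (l : ℂ)).topologicalClosure
  have hbot : ∀ l : ℝ, ¬ c ≤ l → ∀ u ∈ V l, u = 0 := by
    intro l hl u hu
    have : eigenspace A (l : ℂ) = ⊥ :=
      (Submodule.eq_bot_iff _).2 fun x hx => (hpos l x hx).resolve_right hl
    have h2 : u ∈ (eigenspace A (l : ℂ)).topologicalClosure := hu
    rw [this] at h2
    simpa using h2
  have horth : Pairwise fun l m : ℝ => V l ⟂ V m := by
    intro l m hlm
    have h : eigenspace A (l : ℂ) ⟂ eigenspace A (m : ℂ) := by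
      rw [Submodule.isOrtho_iff_inner_eq]
      rintro x ⟨hx, hx'⟩ y ⟨hy, hy'⟩
      have h := hsymm ⟨x, hx⟩ ⟨y, hy⟩
      rw [hx', hy', inner_smul_left, inner_smul_right, Complex.conj_ofReal] at h
      have h' : ((l : ℂ) - m) * inner ℂ x y = 0 := by
        rw [sub_mul]; exact sub_eq_zero.2 h
      rcases mul_eq_zero.1 h' with h' | h'
      · exact absurd (by exact_mod_cast sub_eq_zero.1 h') hlm
      · exact h'
    have h1 : V m ≤ (eigenspace A (l : ℂ))ᗮ :=
      Submodule.topologicalClosure_minimal _ h.symm.le (Submodule.isClosed_orthogonal _)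
    have h2 : V l ≤ (V m)ᗮ :=
      Submodule.topologicalClosure_minimal _ (Submodule.IsOrtho.symm (U := V m) h1)
        (Submodule.isClosed_orthogonal _)
    exact h2
  have hfam : OrthogonalFamily ℂ (fun l => V l) fun l => (V l).subtypeₗᵢ :=
    OrthogonalFamily.of_pairwise horth
  rw [eq_top_iff]
  intro u _
  change Summable fun l : ℝ => ((l ^ γ : ℝ) : ℂ) • spectralProj A l u
  have hproj : ∀ l : ℝ, spectralProj A l u = ((V l).orthogonalProjectionOnto u : H) := fun l => rfl
  let f : ∀ l : ℝ, V l := fun l => ((l ^ γ : ℝ) : ℂ) • (V l).orthogonalProjectionOnto u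
  have hsum : Summable fun l : ℝ => ‖(V l).orthogonalProjectionOnto u‖ ^ 2 := by
    refine summable_of_sum_le (c := ‖u‖ ^ 2) (fun _ => by positivity) fun s => ?_
    have hn := hfam.norm_sum (fun l => (V l).orthogonalProjectionOnto u) s
    set w : H := ∑ l ∈ s, (V l).subtypeₗᵢ ((V l).orthogonalProjectionOnto u) with hw
    have hin : inner ℂ u w = ((‖w‖ ^ 2 : ℝ) : ℂ) := by
      rw [hn, hw, inner_sum, Complex.ofReal_sum]
      refine Finset.sum_congr rfl fun l _ => ?_
      have h := (V l).inner_orthogonalProjectionOnto_eq_of_mem_right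
        ((V l).orthogonalProjectionOnto u) u
      rw [Submodule.coe_subtypeₗᵢ, Submodule.subtype_apply, ← h, inner_self_eq_norm_sq_to_K]
      simp
    have hle : ‖w‖ ^ 2 ≤ ‖u‖ * ‖w‖ := by
      have := norm_inner_le_norm (𝕜 := ℂ) u w
      rw [hin, Complex.norm_real, Real.norm_of_nonneg (by positivity)] at this
      exact this
    rw [← hn]
    nlinarith [norm_nonneg u, norm_nonneg w, sq_nonneg (‖u‖ - ‖w‖)]
  have hf : Summable fun l : ℝ => ‖f l‖ ^ 2 := by
    refine Summable.of_nonneg_of_le (fun _ => by positivity) (fun l => ?_)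
      (hsum.mul_left ((c ^ γ) ^ 2))
    by_cases hl : c ≤ l
    · have h1 : l ^ γ ≤ c ^ γ := Real.rpow_le_rpow_of_nonpos hc0 hl hγ
      have h2 : 0 ≤ l ^ γ := Real.rpow_nonneg (hc0.le.trans hl) _
      simp only [f, norm_smul, Complex.norm_real, mul_pow, Real.norm_of_nonneg h2]
      gcongr
    · have h0 : f l = 0 := Subtype.ext (hbot l hl _ (f l).2)
      rw [h0, norm_zero, zero_pow two_ne_zero]
      positivity
  have := (hfam.summable_iff_norm_sq_summable f).2 hf
  refine this.congr fun l => ?_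
  rw [hproj]
  simp [f]

end Operator

/-! ### The evolution operator of the coupled system -/

section System

variable {H : Type*} [NormedAddCommGroup H] [InnerProductSpace ℂ H] [CompleteSpace H]

/-- The energy space `D(A^{1/2}) × H × D(A^{1/2}) × H`, with elements `(u, v, y, z)`. -/
abbrev EnergySpace (A : H →ₗ.[ℂ] H) : Type _ :=
  (fracPow A (1 / 2)).domain × H × (fracPow A (1 / 2)).domain × H

/-- `‖(u, v, y, z)‖² = a ‖A^{1/2} u‖² + ‖A^{1/2} y‖² + ‖v‖² + ‖z‖²`. -/
def energyNormSq (A : H →ₗ.[ℂ] H) (a : ℝ) : EnergySpace A → ℝ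
  | (u, v, y, z) =>
    a * ‖fracPow A (1 / 2) u‖ ^ 2 + ‖fracPow A (1 / 2) y‖ ^ 2 + ‖v‖ ^ 2 + ‖z‖ ^ 2

/-- The norm of the energy space. -/
def energyNorm (A : H →ₗ.[ℂ] H) (a : ℝ) (U : EnergySpace A) : ℝ :=
  Real.sqrt (energyNormSq A a U)

/-- The domain of the operator below: `u, y ∈ D(A)` and `v, z ∈ D(A^{1/2})`. (The last condition
`v ∈ D(A ^ γ)` is void when `γ ≤ 0`, see `fracPow_domain_eq_top`.) -/
def systemDomain (A : H →ₗ.[ℂ] H) (γ : ℝ) : Submodule ℂ (EnergySpace A) where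
  carrier := {U | (U.1 : H) ∈ A.domain ∧ U.2.1 ∈ (fracPow A (1 / 2)).domain ∧
    (U.2.2.1 : H) ∈ A.domain ∧ U.2.2.2 ∈ (fracPow A (1 / 2)).domain ∧
    U.2.1 ∈ (fracPow A γ).domain}
  zero_mem' := ⟨zero_mem _, zero_mem _, zero_mem _, zero_mem _, zero_mem _⟩
  add_mem' := fun hU hV => ⟨add_mem hU.1 hV.1, add_mem hU.2.1 hV.2.1,
    add_mem hU.2.2.1 hV.2.2.1, add_mem hU.2.2.2.1 hV.2.2.2.1, add_mem hU.2.2.2.2 hV.2.2.2.2⟩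
  smul_mem' := fun c _ hU => ⟨Submodule.smul_mem _ c hU.1, Submodule.smul_mem _ c hU.2.1,
    Submodule.smul_mem _ c hU.2.2.1, Submodule.smul_mem _ c hU.2.2.2.1,
    Submodule.smul_mem _ c hU.2.2.2.2⟩

/-- `(u, v, y, z) ↦ (v, - a A u - A ^ γ v - α z, z, - A y + α v)` on `systemDomain A γ`. -/
def systemFun (A : H →ₗ.[ℂ] H) (a γ α : ℝ) (U : systemDomain A γ) : EnergySpace A :=
  let u : A.domain := ⟨U.1.1, U.2.1⟩
  let v : (fracPow A (1 / 2)).domain := ⟨U.1.2.1, U.2.2.1⟩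
  let y : A.domain := ⟨U.1.2.2.1, U.2.2.2.1⟩
  let z : (fracPow A (1 / 2)).domain := ⟨U.1.2.2.2, U.2.2.2.2.1⟩
  let v' : (fracPow A γ).domain := ⟨U.1.2.1, U.2.2.2.2.2⟩
  (v, -((a : ℂ) • A u) - fracPow A γ v' - (α : ℂ) • (z : H), z, -(A y) + (α : ℂ) • (v : H))

theorem systemFun_add (A : H →ₗ.[ℂ] H) (a γ α : ℝ) (U V : systemDomain A γ) :
    systemFun A a γ α (U + V) = systemFun A a γ α U + systemFun A a γ α V := by
  have h1 := A.map_add ⟨U.1.1, U.2.1⟩ ⟨V.1.1, V.2.1⟩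
  have h2 := A.map_add ⟨U.1.2.2.1, U.2.2.2.1⟩ ⟨V.1.2.2.1, V.2.2.2.1⟩
  have h3 := (fracPow A γ).map_add ⟨U.1.2.1, U.2.2.2.2.2⟩ ⟨V.1.2.1, V.2.2.2.2.2⟩
  simp only [AddMemClass.mk_add_mk] at h1 h2 h3
  unfold systemFun
  refine Prod.ext (Subtype.ext ?_) (Prod.ext ?_ (Prod.ext (Subtype.ext ?_) ?_))
  · simp
  · simp only [Submodule.coe_add, Prod.fst_add, Prod.snd_add, h1, h3]
    module
  · simp
  · simp only [Submodule.coe_add, Prod.fst_add, Prod.snd_add, h2]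
    module

theorem systemFun_smul (A : H →ₗ.[ℂ] H) (a γ α : ℝ) (c : ℂ) (U : systemDomain A γ) :
    systemFun A a γ α (c • U) = c • systemFun A a γ α U := by
  have h1 := A.map_smul c ⟨U.1.1, U.2.1⟩
  have h2 := A.map_smul c ⟨U.1.2.2.1, U.2.2.2.1⟩
  have h3 := (fracPow A γ).map_smul c ⟨U.1.2.1, U.2.2.2.2.2⟩
  simp only [SetLike.mk_smul_mk] at h1 h2 h3
  unfold systemFun
  refine Prod.ext (Subtype.ext ?_) (Prod.ext ?_ (Prod.ext (Subtype.ext ?_) ?_))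
  · simp
  · simp only [Submodule.coe_smul, Prod.smul_fst, Prod.smul_snd, h1, h3]
    module
  · simp
  · simp only [Submodule.coe_smul, Prod.smul_fst, Prod.smul_snd, h2]
    module

/-- The evolution operator of the coupled system, as an unbounded linear operator in the energy
space. -/
def systemOp (A : H →ₗ.[ℂ] H) (a γ α : ℝ) : EnergySpace A →ₗ.[ℂ] EnergySpace A where
  domain := systemDomain A γ
  toFun :=
    { toFun := systemFun A a γ α
      map_add' := systemFun_add A a γ α
      map_smul' := systemFun_smul A a γ α }

end System

/-! ### Semigroups -/

section Semigroup

variable {E : Type*} [AddCommGroup E] [Module ℂ E]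

/-- `(S t)_{t ≥ 0}` is a `C₀`-semigroup of contractions on `E` for the norm `nrm`. -/
structure IsContractionSemigroup (nrm : E → ℝ) (S : ℝ → E →ₗ[ℂ] E) : Prop where
  map_zero : S 0 = LinearMap.id
  map_add : ∀ s t : ℝ, 0 ≤ s → 0 ≤ t → S (s + t) = S s ∘ₗ S t
  contraction : ∀ t : ℝ, 0 ≤ t → ∀ x : E, nrm (S t x) ≤ nrm x
  continuous : ∀ x : E, Tendsto (fun t : ℝ => nrm (S t x - x)) (𝓝[>] 0) (𝓝 0)

/-- `B` is the infinitesimal generator of `(S t)_{t ≥ 0}`: `x ∈ D(B)` and `B x = w` hold if and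
only if `(S t x - x) / t` tends to `w` as `t` decreases to `0`. -/
def IsGenerator (nrm : E → ℝ) (S : ℝ → E →ₗ[ℂ] E) (B : E →ₗ.[ℂ] E) : Prop :=
  ∀ x w : E, (∃ h : x ∈ B.domain, B ⟨x, h⟩ = w) ↔
    Tendsto (fun t : ℝ => nrm (((t⁻¹ : ℝ) : ℂ) • (S t x - x) - w)) (𝓝[>] 0) (𝓝 0)

end Semigroup

/-! ### The energy and its decay -/

section Decay

variable {H : Type*} [NormedAddCommGroup H] [InnerProductSpace ℂ H] [CompleteSpace H]

/-- `S` is the contraction semigroup on the energy space generated by `systemOp A a γ α`. Its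
orbits `t ↦ S t U₀` with `U₀` in the domain of the generator are the solutions
`(u, u_t, y, y_t)` of the coupled system. -/
def IsSystemSemigroup (A : H →ₗ.[ℂ] H) (a γ α : ℝ)
    (S : ℝ → EnergySpace A →ₗ[ℂ] EnergySpace A) : Prop :=
  IsContractionSemigroup (energyNorm A a) S ∧
    IsGenerator (energyNorm A a) S (systemOp A a γ α)

/-- The energy at time `t` of the solution with initial state `U₀`. -/
def energy (A : H →ₗ.[ℂ] H) (a : ℝ) (S : ℝ → EnergySpace A →ₗ[ℂ] EnergySpace A)
    (U₀ : EnergySpace A) (t : ℝ) : ℝ :=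
  1 / 2 * energyNormSq A a (S t U₀)

/-- There is `C > 0` with `E(t) ≤ C / t ^ r * ‖𝒜 U₀‖²` for all `U₀ ∈ D(𝒜)` and all `t > 0`. -/
def EnergyDecaysAtRate (A : H →ₗ.[ℂ] H) (a γ α : ℝ)
    (S : ℝ → EnergySpace A →ₗ[ℂ] EnergySpace A) (r : ℝ) : Prop :=
  ∃ C : ℝ, 0 < C ∧ ∀ U₀ : (systemOp A a γ α).domain, ∀ t : ℝ, 0 < t →
    energy A a S U₀ t ≤ C / t ^ r * energyNorm A a (systemOp A a γ α U₀) ^ 2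

/-- The exponent `δ(γ)`. -/
def decayExponent (a γ : ℝ) : ℝ :=
  if a = 1 then -1 / γ else 1 / (1 - γ)

end Decay

end CoupledSystem

end

/-!
The system splits along an orthonormal basis of eigenvectors of `A` (`exists_eigenbasis`, from the
spectral theorem for the compact inverse of `A`). In the coordinates `(√(a l) u, v, √l y, z)` along
an eigenvector with eigenvalue `l`, the energy space becomes the Hilbert sum of copies of `ℂ⁴` and
the evolution operator the diagonal operator, on its maximal domain, with dissipative `4 × 4` blocks
`M` (`modeMap`, `systemOp_graph_iff`). The semigroup is `e ^ (t M)` in each block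
(`isContractionSemigroup_modeFlow`, `modeFlow_generator`), and any semigroup with the same generator
acts in this way on the domain (`semigroup_apply_eq_flow`), so that everything reduces to estimates
for `e ^ (t M)` which are uniform in `l`.

*Decay.* Put `ω = l ^ γ` if `a = 1` and `ω = l ^ (γ - 1)` otherwise (`modeRate`); then
`ω ^ δ(γ) = 1 / l`. Adding to `‖x‖²` a multiple of `ω` times a quadratic form in which the coupling
carries the damping over from `v` to `z`, one obtains a Lyapunov functional and
`‖e ^ (t M) x‖² ≤ 4 e ^ (-κ ω t) ‖x‖²` with `κ` independent of `l` (`exists_mode_exp_decay`). The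
derivative of this form contains `(a - 1) l Re (v ȳ)`, up to a constant factor, which vanishes for
`a = 1`; otherwise the damping `l ^ γ |v|²` absorbs it only when `ω l` is at most of order `l ^ γ`.
Since `‖x‖² ≤ (C / l) ‖M x‖²`, boundedness of `s ^ δ e ^ (-κ s)` gives the rate
`t ^ (-δ(γ))` (`exists_systemMode_decay`).

*Optimality.* Without damping, `M` is skew-adjoint and has an eigenvector whose `v`-component
satisfies `l ^ γ |v|² ≤ C ω ‖x‖²`. Under the damped flow it keeps a fixed fraction of its size up to
times of order `1 / ω` (`norm_le_norm_flow_of_eigenvector`, `exists_slow_orbit`), while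
`‖M x‖² ≤ C l ‖x‖²`. A decay at the rate `δ(γ) + ε` would bound `ω ^ ε` from below, hence `l` from
above (`exists_le_of_systemMode_decay`); but in infinite dimension the eigenvalues are unbounded
(`exists_eigenIndex_gt`).
-/

namespace CoupledSystem

/-! ### Exponentials of dissipative bounded operators -/

section Flow

variable {V : Type*} [NormedAddCommGroup V] [InnerProductSpace ℂ V] [CompleteSpace V]

/-- The group `e ^ (t M)` of a bounded operator `M`, for real times. -/
noncomputable def flow (M : V →L[ℂ] V) (t : ℝ) : V →L[ℂ] V :=
  NormedSpace.exp ((t : ℂ) • M)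

theorem flow_zero (M : V →L[ℂ] V) : flow M 0 = 1 := by
  simp [flow]

theorem flow_add (M : V →L[ℂ] V) (s t : ℝ) : flow M (s + t) = flow M s * flow M t := by
  unfold flow
  rw [Complex.ofReal_add, add_smul]
  refine NormedSpace.exp_add_of_commute_of_mem_ball (𝕂 := ℂ)
    (((Commute.refl M).smul_left _).smul_right _) ?_ ?_ <;>
  exact (NormedSpace.expSeries_radius_eq_top ℂ (V →L[ℂ] V)).symm ▸ edist_lt_top _ _

theorem flow_apply_comm (M : V →L[ℂ] V) (t : ℝ) (x : V) :
    flow M t (M x) = M (flow M t x) := by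
  have h : Commute (flow M t) M := ((Commute.refl M).smul_left (t : ℂ)).exp_left
  exact DFunLike.congr_fun h.eq x

theorem hasDerivAt_flow (M : V →L[ℂ] V) (x : V) (t : ℝ) :
    HasDerivAt (fun s => flow M s x) (M (flow M t x)) t := by
  have h1 := (hasDerivAt_exp_smul_const' (𝕂 := ℂ) M (t : ℂ)).scomp t Complex.ofRealCLM.hasDerivAt
  simp only [Complex.ofRealCLM_apply, Complex.ofReal_one, one_smul] at h1
  exact (((ContinuousLinearMap.apply ℂ V x).restrictScalars ℝ).hasFDerivAt.comp_hasDerivAt t h1)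

theorem continuous_flow (M : V →L[ℂ] V) (x : V) : Continuous fun s => flow M s x :=
  continuous_iff_continuousAt.2 fun t => (hasDerivAt_flow M x t).continuousAt

/-- Dissipativity: `Re ⟨M x, x⟩ ≤ 0`. -/
def IsDissipative (M : V →L[ℂ] V) : Prop :=
  ∀ x, (inner ℂ (M x) x).re ≤ 0

theorem IsDissipative.norm_flow_le {M : V →L[ℂ] V} (hM : IsDissipative M) {t : ℝ} (ht : 0 ≤ t)
    (x : V) : ‖flow M t x‖ ≤ ‖x‖ := by
  let _ : InnerProductSpace ℝ V := InnerProductSpace.complexToReal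
  have hd : ∀ s : ℝ, HasDerivAt (fun s => ‖flow M s x‖ ^ 2)
      (2 * inner ℝ (flow M s x) (M (flow M s x))) s := fun s => (hasDerivAt_flow M x s).norm_sq
  have hanti : Antitone fun s : ℝ => ‖flow M s x‖ ^ 2 := by
    refine antitone_of_deriv_nonpos (fun s => (hd s).differentiableAt) fun s => ?_
    rw [(hd s).deriv, real_inner_comm, real_inner_eq_re_inner ℂ]
    exact mul_nonpos_of_nonneg_of_nonpos zero_le_two (hM (flow M s x))
  have h := hanti ht
  simp only [flow_zero, one_apply_eq_self] at h
  exact le_of_sq_le_sq h (norm_nonneg _)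

theorem IsDissipative.norm_flow_sub_le {M : V →L[ℂ] V} (hM : IsDissipative M) {t : ℝ}
    (ht : 0 ≤ t) (x : V) : ‖flow M t x - x‖ ≤ t * ‖M x‖ := by
  have h := norm_image_sub_le_of_norm_deriv_le_segment' (f := fun s => flow M s x)
    (f' := fun s => M (flow M s x)) (C := ‖M x‖) (a := 0) (b := t)
    (fun s _ => (hasDerivAt_flow M x s).hasDerivWithinAt)
    (fun s hs => by
      rw [← flow_apply_comm]
      exact hM.norm_flow_le hs.1 _) t ⟨ht, le_rfl⟩
  simpa [flow_zero, mul_comm] using h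

theorem tendsto_flow_slope (M : V →L[ℂ] V) (x : V) :
    Tendsto (fun t : ℝ => ((t⁻¹ : ℝ) : ℂ) • (flow M t x - x)) (𝓝[>] 0) (𝓝 (M x)) := by
  have h := (hasDerivAt_flow M x 0).tendsto_slope_zero_right
  simp only [zero_add, flow_zero, one_apply_eq_self] at h
  exact h.congr fun t => (Complex.coe_smul _ _).symm

end Flow

/-! ### Families of dissipative modes -/

section Modes

variable {ι : Type*} {V : Type*} [NormedAddCommGroup V]

theorem summable_norm_sq (X : lp (fun _ : ι => V) 2) : Summable fun i => ‖X i‖ ^ 2 := by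
  simpa using (lp.memℓp X).summable (by simp)

theorem norm_sq_eq_tsum (X : lp (fun _ : ι => V) 2) : ‖X‖ ^ 2 = ∑' i, ‖X i‖ ^ 2 := by
  simpa using lp.norm_rpow_eq_tsum (p := 2) (by simp) X

theorem memℓp_two_iff {E : Type*} [NormedAddCommGroup E] {f : ι → E} :
    Memℓp f 2 ↔ Summable fun i => ‖f i‖ ^ 2 := by
  simpa using memℓp_gen_iff (p := 2) (f := f) (by simp)

theorem tendsto_norm_of_dominated {F : ℝ → lp (fun _ : ι => V) 2} {l : Filter ℝ} {g : ι → ℝ}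
    (hg : Summable g) (hF : ∀ i, Tendsto (fun t => F t i) l (𝓝 0))
    (hb : ∀ᶠ t in l, ∀ i, ‖F t i‖ ^ 2 ≤ g i) : Tendsto (fun t => ‖F t‖) l (𝓝 0) := by
  have h := tendsto_tsum_of_dominated_convergence (f := fun t i => ‖F t i‖ ^ 2)
    (g := fun _ : ι => (0 : ℝ)) (𝓕 := l) hg
    (fun i => by simpa using ((hF i).norm.pow 2))
    (by simpa using hb)
  simp only [← norm_sq_eq_tsum, tsum_zero] at h
  simpa using h.sqrt

theorem lp_quotient_apply [NormedSpace ℂ V] (c : ℂ) (X Y W : lp (fun _ : ι => V) 2) (i : ι) :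
    (c • (X - Y) - W) i = c • (X i - Y i) - W i := rfl

variable [InnerProductSpace ℂ V] [CompleteSpace V] {M : ι → V →L[ℂ] V}

/-- The operators `e ^ (t M i)` acting on each coordinate of a square summable family (the identity
for `t < 0`). -/
noncomputable def modeFlow (hM : ∀ i, IsDissipative (M i)) (t : ℝ) :
    lp (fun _ : ι => V) 2 →ₗ[ℂ] lp (fun _ : ι => V) 2 where
  toFun X := ⟨fun i => flow (M i) (max t 0) (X i), memℓp_two_iff.2 <|
    (summable_norm_sq X).of_nonneg_of_le (fun _ => by positivity) fun i => by
      have := (hM i).norm_flow_le (le_max_right t 0) (X i)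
      gcongr⟩
  map_add' X Y := lp.ext <| funext fun i => map_add (flow (M i) (max t 0)) (X i) (Y i)
  map_smul' c X := lp.ext <| funext fun i => map_smul (flow (M i) (max t 0)) c (X i)

theorem modeFlow_apply (hM : ∀ i, IsDissipative (M i)) {t : ℝ} (ht : 0 ≤ t)
    (X : lp (fun _ : ι => V) 2) (i : ι) : modeFlow hM t X i = flow (M i) t (X i) := by
  simp [modeFlow, max_eq_left ht]

theorem isContractionSemigroup_modeFlow (hM : ∀ i, IsDissipative (M i)) :
    IsContractionSemigroup (fun X => ‖X‖) (modeFlow hM) where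
  map_zero := by
    ext X i
    simp [modeFlow_apply hM le_rfl, flow_zero]
  map_add s t hs ht := by
    ext X i
    simp [modeFlow_apply hM (add_nonneg hs ht), modeFlow_apply hM hs, modeFlow_apply hM ht,
      flow_add]
  contraction t ht X := by
    refine le_of_sq_le_sq ?_ (norm_nonneg _)
    rw [norm_sq_eq_tsum, norm_sq_eq_tsum]
    refine (summable_norm_sq _).tsum_le_tsum (fun i => ?_) (summable_norm_sq _)
    rw [modeFlow_apply hM ht]
    have := (hM i).norm_flow_le ht (X i)
    gcongr
  continuous X := by
    refine tendsto_norm_of_dominated ((summable_norm_sq X).mul_left 4) (fun i => ?_) ?_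
    · have h : Tendsto (fun t => flow (M i) t (X i) - X i) (𝓝[>] 0) (𝓝 0) := by
        have := ((continuous_flow (M i) (X i)).tendsto 0).sub_const (X i)
        simp only [flow_zero, one_apply_eq_self, sub_self] at this
        exact this.mono_left nhdsWithin_le_nhds
      refine h.congr' ?_
      filter_upwards [self_mem_nhdsWithin] with t ht
      simp [modeFlow_apply hM (le_of_lt ht)]
    · filter_upwards [self_mem_nhdsWithin] with t ht i
      have h1 := (hM i).norm_flow_le (le_of_lt ht) (X i)
      have h2 := norm_sub_le (flow (M i) t (X i)) (X i)
      have h3 : ‖flow (M i) t (X i) - X i‖ ≤ 2 * ‖X i‖ := by linarith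
      calc _ = ‖flow (M i) t (X i) - X i‖ ^ 2 := by simp [modeFlow_apply hM (le_of_lt ht)]
        _ ≤ (2 * ‖X i‖) ^ 2 := by gcongr
        _ = _ := by ring

/-- The generator of `modeFlow` is the diagonal operator with entries `M i`, on its maximal
domain. -/
theorem modeFlow_generator (hM : ∀ i, IsDissipative (M i)) (X W : lp (fun _ : ι => V) 2) :
    (∀ i, W i = M i (X i)) ↔
      Tendsto (fun t : ℝ => ‖((t⁻¹ : ℝ) : ℂ) • (modeFlow hM t X - X) - W‖) (𝓝[>] 0) (𝓝 0) := by
  constructor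
  · intro hW
    refine tendsto_norm_of_dominated ((summable_norm_sq W).mul_left 4) (fun i => ?_) ?_
    · have h := (tendsto_flow_slope (M i) (X i)).sub_const (W i)
      rw [hW i, sub_self] at h
      refine h.congr' ?_
      filter_upwards [self_mem_nhdsWithin] with t ht
      rw [lp_quotient_apply, modeFlow_apply hM (le_of_lt ht), hW i]
    · filter_upwards [self_mem_nhdsWithin] with t ht i
      have ht' : 0 < t := ht
      have h1 := (hM i).norm_flow_sub_le ht'.le (X i)
      rw [← hW i] at h1
      have h2 : ‖((t⁻¹ : ℝ) : ℂ) • (flow (M i) t (X i) - X i)‖ ≤ ‖W i‖ := by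
        rw [norm_smul, Complex.norm_real, Real.norm_of_nonneg (by positivity)]
        calc _ ≤ t⁻¹ * (t * ‖W i‖) := by gcongr
          _ = _ := by field_simp
      have h3 := norm_sub_le (((t⁻¹ : ℝ) : ℂ) • (flow (M i) t (X i) - X i)) (W i)
      have h4 : ‖((t⁻¹ : ℝ) : ℂ) • (flow (M i) t (X i) - X i) - W i‖ ≤ 2 * ‖W i‖ := by linarith
      calc _ = ‖((t⁻¹ : ℝ) : ℂ) • (flow (M i) t (X i) - X i) - W i‖ ^ 2 := by
            rw [lp_quotient_apply, modeFlow_apply hM ht'.le]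
        _ ≤ (2 * ‖W i‖) ^ 2 := by gcongr
        _ = _ := by ring
  · intro h i
    have h1 : Tendsto (fun t : ℝ => ((t⁻¹ : ℝ) : ℂ) • (flow (M i) t (X i) - X i) - W i)
        (𝓝[>] 0) (𝓝 0) := by
      refine squeeze_zero_norm' ?_ h
      filter_upwards [self_mem_nhdsWithin] with t ht
      have := lp.norm_apply_le_norm (by simp)
        (((t⁻¹ : ℝ) : ℂ) • (modeFlow hM t X - X) - W) i
      rwa [lp_quotient_apply, modeFlow_apply hM (le_of_lt ht)] at this
    have h2 := (tendsto_flow_slope (M i) (X i)).sub_const (W i)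
    exact (sub_eq_zero.1 (tendsto_nhds_unique h2 h1)).symm

/-- A contraction semigroup generated by the diagonal operator with entries `M i` is
`e ^ (t M i)` in each coordinate, on the domain of the generator. -/
theorem semigroup_apply_eq_flow
    {T : ℝ → lp (fun _ : ι => V) 2 →ₗ[ℂ] lp (fun _ : ι => V) 2}
    (hT : IsContractionSemigroup (fun X => ‖X‖) T)
    (hgen : ∀ X W : lp (fun _ : ι => V) 2, (∀ i, W i = M i (X i)) ↔
      Tendsto (fun t : ℝ => ‖((t⁻¹ : ℝ) : ℂ) • (T t X - X) - W‖) (𝓝[>] 0) (𝓝 0))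
    {X W : lp (fun _ : ι => V) 2} (hXW : ∀ i, W i = M i (X i)) {t : ℝ} (ht : 0 ≤ t) (i : ι) :
    T t X i = flow (M i) t (X i) := by
  have hX := (hgen X W).1 hXW
  have key : ∀ s, 0 ≤ s → ∀ h, 0 ≤ h → T (s + h) X - T s X = T s (T h X - X) := by
    intro s hs h hh
    rw [hT.map_add s h hs hh, map_sub, LinearMap.comp_apply]
  have hquot : ∀ s, 0 ≤ s →
      Tendsto (fun h : ℝ => ‖((h⁻¹ : ℝ) : ℂ) • (T (s + h) X - T s X) - T s W‖)
        (𝓝[>] 0) (𝓝 0) := by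
    intro s hs
    refine squeeze_zero' (Eventually.of_forall fun _ => norm_nonneg _) ?_ hX
    filter_upwards [self_mem_nhdsWithin] with h hh
    rw [key s hs h (le_of_lt hh), ← map_smul, ← map_sub]
    exact hT.contraction s hs _
  -- the orbit stays in the domain of the generator, which commutes with `T s`
  have hdom : ∀ s, 0 ≤ s → T s W i = M i (T s X i) := by
    intro s hs
    refine (hgen (T s X) (T s W)).2 ((hquot s hs).congr' ?_) i
    filter_upwards [self_mem_nhdsWithin] with h hh
    have hh' : 0 ≤ h := le_of_lt hh
    rw [add_comm s h, hT.map_add h s hh' hs, LinearMap.comp_apply]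
  -- only right derivatives are available, and they suffice for uniqueness
  have hderiv : ∀ s, 0 ≤ s →
      HasDerivWithinAt (fun r => T r X i) (M i (T s X i)) (Set.Ici s) s := by
    intro s hs
    rw [← hasDerivWithinAt_Ioi_iff_Ici, hasDerivWithinAt_iff_tendsto_slope' (by simp)]
    rw [tendsto_iff_norm_sub_tendsto_zero]
    have hshift : Tendsto (fun r : ℝ => r - s) (𝓝[>] s) (𝓝[>] 0) := by
      refine tendsto_nhdsWithin_of_tendsto_nhds_of_eventually_within _ ?_ ?_
      · have : Tendsto (fun r : ℝ => r - s) (𝓝 s) (𝓝 (s - s)) := tendsto_id.sub_const s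
        rw [sub_self] at this
        exact this.mono_left nhdsWithin_le_nhds
      · filter_upwards [self_mem_nhdsWithin] with r hr
        exact Set.mem_Ioi.2 (sub_pos.2 hr)
    refine squeeze_zero' (Eventually.of_forall fun _ => norm_nonneg _) ?_
      ((hquot s hs).comp hshift)
    refine Eventually.of_forall fun r => ?_
    have := lp.norm_apply_le_norm (by simp)
      ((((r - s)⁻¹ : ℝ) : ℂ) • (T (s + (r - s)) X - T s X) - T s W) i
    rw [lp_quotient_apply, add_sub_cancel] at this
    rw [← hdom s hs, slope_def_module, ← Complex.coe_smul]
    simpa only [Function.comp_def, add_sub_cancel] using this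
  have hcont : ∀ {r s : ℝ}, 0 ≤ r → r ≤ s → ‖T s X i - T r X i‖ ≤ ‖T (s - r) X - X‖ := by
    intro r s hr hrs
    have h1 := key r hr (s - r) (sub_nonneg.2 hrs)
    rw [add_sub_cancel] at h1
    have h2 := lp.norm_apply_le_norm (by simp) (T s X - T r X) i
    refine le_trans (by simpa using h2) ?_
    rw [h1]
    exact hT.contraction r hr _
  have hcontOn : ContinuousOn (fun r => T r X i) (Set.Icc 0 t) := by
    rw [Metric.continuousOn_iff]
    intro s hs ε hε
    obtain ⟨δ, hδ, hδε⟩ := (Metric.tendsto_nhdsWithin_nhds.1 (hT.continuous X)) ε hε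
    refine ⟨δ, hδ, fun r hr hrs => ?_⟩
    have hsmall : ∀ h, 0 < h → h < δ → ‖T h X - X‖ < ε := by
      intro h h0 h1
      have := hδε h0 (by simpa [abs_of_pos h0] using h1)
      simpa using this
    rw [Real.dist_eq] at hrs
    rcases lt_trichotomy r s with hlt | rfl | hlt
    · rw [dist_comm, dist_eq_norm]
      refine (hcont hr.1 hlt.le).trans_lt (hsmall _ (sub_pos.2 hlt) ?_)
      rwa [abs_sub_comm, abs_of_pos (sub_pos.2 hlt)] at hrs
    · simpa using hε
    · rw [dist_eq_norm]
      refine (hcont hs.1 hlt.le).trans_lt (hsmall _ (sub_pos.2 hlt) ?_)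
      rwa [abs_of_pos (sub_pos.2 hlt)] at hrs
  refine ODE_solution_unique_of_mem_Icc_right (v := fun _ x => M i x) (s := fun _ => Set.univ)
    (K := ‖M i‖₊) (f := fun r => T r X i) (g := fun r => flow (M i) r (X i)) (a := 0) (b := t)
    (fun _ _ => (M i).lipschitz.lipschitzOnWith) hcontOn (fun s hs => hderiv s hs.1)
    (fun _ _ => trivial) (continuous_flow _ _).continuousOn
    (fun s _ => (hasDerivAt_flow (M i) (X i) s).hasDerivWithinAt) (fun _ _ => trivial) ?_
    ⟨ht, le_rfl⟩
  simp [hT.map_zero, flow_zero]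

end Modes

/-! ### A single mode -/

section Mode

/-- The coordinates `(√(a l) u, v, √l y, z)` of a state along an eigenvector of `A` with
eigenvalue `l`; their Euclidean norm is the norm of the energy space. -/
abbrev ModeSpace : Type := EuclideanSpace ℂ (Fin 4)

/-- The matrix of the system along an eigenvector of `A`, in the coordinates of `ModeSpace`. Here
`b = √a`, `s` is the square root of the eigenvalue, and `d` is its power `γ`. -/
noncomputable def modeOp (b s d α : ℝ) : ModeSpace →L[ℂ] ModeSpace :=
  LinearMap.toContinuousLinearMap
    { toFun := fun x => !₂[(b * s : ℂ) * x 1, -(b * s : ℂ) * x 0 - d * x 1 - α * x 3,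
        s * x 3, -s * x 2 + α * x 1]
      map_add' := fun x y => by
        ext i; fin_cases i <;> simp <;> ring
      map_smul' := fun c x => by
        ext i; fin_cases i <;> simp <;> ring }

variable (b s d α : ℝ) (x : ModeSpace)

theorem modeOp_apply_zero : modeOp b s d α x 0 = (b * s : ℂ) * x 1 := by simp [modeOp]
theorem modeOp_apply_one :
    modeOp b s d α x 1 = -(b * s : ℂ) * x 0 - d * x 1 - α * x 3 := by simp [modeOp]
theorem modeOp_apply_two : modeOp b s d α x 2 = s * x 3 := by simp [modeOp]
theorem modeOp_apply_three : modeOp b s d α x 3 = -s * x 2 + α * x 1 := by simp [modeOp]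

theorem modeSpace_norm_sq :
    ‖x‖ ^ 2 = ‖x 0‖ ^ 2 + ‖x 1‖ ^ 2 + ‖x 2‖ ^ 2 + ‖x 3‖ ^ 2 := by
  rw [EuclideanSpace.norm_sq_eq, Fin.sum_univ_four]

theorem real_inner_eq (z w : ℂ) : inner ℝ z w = z.re * w.re + z.im * w.im := by
  rw [Complex.inner]
  simp [mul_comm]

theorem inner_modeOp_self : (inner ℂ (modeOp b s d α x) x).re = -d * ‖x 1‖ ^ 2 := by
  rw [PiLp.inner_apply, Fin.sum_univ_four, modeOp_apply_zero, modeOp_apply_one, modeOp_apply_two,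
    modeOp_apply_three, Complex.sq_norm, Complex.normSq_apply]
  simp
  ring

theorem isDissipative_modeOp {d : ℝ} (hd : 0 ≤ d) : IsDissipative (modeOp b s d α) := by
  intro x
  rw [inner_modeOp_self]
  have := mul_nonneg hd (sq_nonneg ‖x 1‖)
  linarith

theorem hasDerivAt_flow_apply (t : ℝ) (j : Fin 4) :
    HasDerivAt (fun r => flow (modeOp b s d α) r x j)
      (modeOp b s d α (flow (modeOp b s d α) t x) j) t :=
  (((EuclideanSpace.proj (𝕜 := ℂ) j).restrictScalars ℝ).hasFDerivAt.comp_hasDerivAt t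
    (hasDerivAt_flow (modeOp b s d α) x t))

/-- `‖e^(tM) x‖²` decreases at the rate `2 d |v|²`. -/
theorem hasDerivAt_norm_sq_flow (t : ℝ) :
    HasDerivAt (fun r => ‖flow (modeOp b s d α) r x‖ ^ 2)
      (-2 * d * ‖flow (modeOp b s d α) t x 1‖ ^ 2) t := by
  let _ : InnerProductSpace ℝ ModeSpace := InnerProductSpace.complexToReal
  have h := (hasDerivAt_flow (modeOp b s d α) x t).norm_sq
  rw [real_inner_comm, real_inner_eq_re_inner ℂ] at h
  have h2 := inner_modeOp_self b s d α (flow (modeOp b s d α) t x)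
  have h3 : RCLike.re (inner ℂ (modeOp b s d α (flow (modeOp b s d α) t x))
    (flow (modeOp b s d α) t x)) = -d * ‖flow (modeOp b s d α) t x 1‖ ^ 2 := h2
  rw [h3] at h
  convert! h using 1
  ring

variable {b s d α : ℝ}

/-- The correction added to `‖x‖²` to obtain a Lyapunov functional. In the original variables it is
`K α (Re (v z̄) + a l Re (u ȳ)) + Re (u v̄) + Re (y z̄)`: the first bracket transfers the
dissipation of `v` to `z` through the coupling, the rest is the equipartition of energy. -/
noncomputable def multiplier (b s α K : ℝ) (x : ModeSpace) : ℝ :=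
  K * α * (inner ℝ (x 1) (x 3) + b * inner ℝ (x 0) (x 2)) +
    ((b * s)⁻¹ * inner ℝ (x 0) (x 1) + s⁻¹ * inner ℝ (x 2) (x 3))

/-- The derivative of `multiplier` along the flow. -/
noncomputable def multiplierDeriv (b s d α K : ℝ) (x : ModeSpace) : ℝ :=
  K * α ^ 2 * (‖x 1‖ ^ 2 - ‖x 3‖ ^ 2) - K * α * d * inner ℝ (x 1) (x 3) +
    K * α * (b ^ 2 - 1) * s * inner ℝ (x 1) (x 2) +
    (‖x 1‖ ^ 2 - ‖x 0‖ ^ 2 + ‖x 3‖ ^ 2 - ‖x 2‖ ^ 2) -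
    d * (b * s)⁻¹ * inner ℝ (x 0) (x 1) - α * (b * s)⁻¹ * inner ℝ (x 0) (x 3) +
    α * s⁻¹ * inner ℝ (x 2) (x 1)

theorem hasDerivAt_multiplier (hb : b ≠ 0) (hs : s ≠ 0) (K : ℝ) (x : ModeSpace) (t : ℝ) :
    HasDerivAt (fun r => multiplier b s α K (flow (modeOp b s d α) r x))
      (multiplierDeriv b s d α K (flow (modeOp b s d α) t x)) t := by
  have h := hasDerivAt_flow_apply b s d α x t
  have h13 := (h 1).inner ℝ (h 3)
  have h02 := (h 0).inner ℝ (h 2)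
  have h01 := (h 0).inner ℝ (h 1)
  have h23 := (h 2).inner ℝ (h 3)
  have H := ((h13.add (h02.const_mul b)).const_mul (K * α)).add
    ((h01.const_mul (b * s)⁻¹).add (h23.const_mul s⁻¹))
  refine H.congr_deriv ?_
  generalize flow (modeOp b s d α) t x = y
  simp only [modeOp_apply_zero, modeOp_apply_one, modeOp_apply_two, modeOp_apply_three,
    multiplierDeriv, real_inner_eq, Complex.sq_norm, Complex.normSq_apply]
  simp
  field_simp
  ring

theorem abs_inner_le_norm_sq (x : ModeSpace) {i j : Fin 4} (hij : i ≠ j) :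
    |inner ℝ (x i) (x j)| ≤ ‖x‖ ^ 2 / 2 := by
  have h1 := abs_real_inner_le_norm (x i) (x j)
  have h2 : ‖x i‖ ^ 2 + ‖x j‖ ^ 2 ≤ ‖x‖ ^ 2 := by
    rw [EuclideanSpace.norm_sq_eq, ← Finset.sum_pair hij (f := fun i => ‖x i‖ ^ 2)]
    exact Finset.sum_le_sum_of_subset_of_nonneg (Finset.subset_univ _) fun _ _ _ => by positivity
  nlinarith [sq_nonneg (‖x i‖ - ‖x j‖)]

end Mode

/-! ### Uniform decay of the modes -/

section Decay

theorem mul_real_inner_le {c c' : ℝ} (hc : |c| ≤ c') (z w : ℂ) :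
    c * inner ℝ z w ≤ ‖z‖ ^ 2 / 4 + c' ^ 2 * ‖w‖ ^ 2 := by
  have h1 : c * inner ℝ z w ≤ c' * (‖z‖ * ‖w‖) := by
    refine (le_abs_self _).trans ?_
    rw [abs_mul]
    exact mul_le_mul hc (abs_real_inner_le_norm z w) (abs_nonneg _) ((abs_nonneg _).trans hc)
  nlinarith [sq_nonneg (‖z‖ / 2 - c' * ‖w‖)]

theorem abs_multiplier_le {b s s₀ : ℝ} (α K : ℝ) (hb : 0 < b) (hs₀ : 0 < s₀) (hs : s₀ ≤ s)
    (x : ModeSpace) :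
    |multiplier b s α K x| ≤ (|K * α| * (1 + b) + (b * s₀)⁻¹ + s₀⁻¹) / 2 * ‖x‖ ^ 2 := by
  have h13 := abs_inner_le_norm_sq x (i := 1) (j := 3) (by decide)
  have h02 := abs_inner_le_norm_sq x (i := 0) (j := 2) (by decide)
  have h01 := abs_inner_le_norm_sq x (i := 0) (j := 1) (by decide)
  have h23 := abs_inner_le_norm_sq x (i := 2) (j := 3) (by decide)
  have hs' : 0 < s := hs₀.trans_le hs
  unfold multiplier
  calc _ ≤ |K * α| * (|inner ℝ (x 1) (x 3)| + b * |inner ℝ (x 0) (x 2)|) +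
        ((b * s)⁻¹ * |inner ℝ (x 0) (x 1)| + s⁻¹ * |inner ℝ (x 2) (x 3)|) := by
        refine (abs_add_le _ _).trans (add_le_add ?_ ((abs_add_le _ _).trans_eq ?_))
        · rw [abs_mul]
          refine mul_le_mul_of_nonneg_left ((abs_add_le _ _).trans_eq ?_) (abs_nonneg _)
          rw [abs_mul b, abs_of_pos hb]
        · rw [abs_mul, abs_mul, abs_of_pos (by positivity : 0 < (b * s)⁻¹),
            abs_of_pos (by positivity : 0 < s⁻¹)]
    _ ≤ |K * α| * (‖x‖ ^ 2 / 2 + b * (‖x‖ ^ 2 / 2)) +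
        ((b * s₀)⁻¹ * (‖x‖ ^ 2 / 2) + s₀⁻¹ * (‖x‖ ^ 2 / 2)) := by
        gcongr
    _ = _ := by ring

/-- The factor `K` for which the coupling term of `multiplier` dominates the energy of `z`. -/
noncomputable def couplingFactor (b s₀ α : ℝ) : ℝ := (2 + (α / (b * s₀)) ^ 2) / α ^ 2

theorem multiplierDeriv_le {b s s₀ d D α : ℝ} (hb : 0 < b) (hα : α ≠ 0) (hs₀ : 0 < s₀)
    (hs : s₀ ≤ s) (hd : 0 < d) (hdD : d ≤ D) (x : ModeSpace) {K : ℝ}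
    (hK : K = couplingFactor b s₀ α) :
    multiplierDeriv b s d α K x ≤ -(‖x 0‖ ^ 2 + ‖x 2‖ ^ 2 + ‖x 3‖ ^ 2) / 2 +
      (K * α ^ 2 + 1 + (|K * α| * D) ^ 2 + (D / (b * s₀)) ^ 2 + (α / s₀) ^ 2) * ‖x 1‖ ^ 2 +
      (K * α) ^ 2 * ((b ^ 2 - 1) ^ 2 * s ^ 2) * ‖x 1‖ ^ 2 := by
  have hs' : 0 < s := hs₀.trans_le hs
  have hD : 0 < D := hd.trans_le hdD
  have hKα : K * α ^ 2 = 2 + (α / (b * s₀)) ^ 2 := by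
    rw [hK, couplingFactor]
    field_simp
  have hinv : (b * s)⁻¹ ≤ (b * s₀)⁻¹ := by gcongr
  -- Young's inequality for the mixed terms, with the weight on `v` wherever `v` occurs; `h2` keeps
  -- its dependence on `s`
  have h1 : -(K * α * d) * inner ℝ (x 3) (x 1) ≤ _ :=
    mul_real_inner_le (c' := |K * α| * D) (by
      rw [abs_neg, abs_mul, abs_of_pos hd]
      gcongr) _ _
  have h2 : (K * α * (b ^ 2 - 1) * s) * inner ℝ (x 2) (x 1) ≤ _ := mul_real_inner_le le_rfl _ _
  have h3 : -(d * (b * s)⁻¹) * inner ℝ (x 0) (x 1) ≤ _ :=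
    mul_real_inner_le (c' := D / (b * s₀)) (by
      rw [abs_neg, abs_of_pos (by positivity), div_eq_mul_inv]
      gcongr) _ _
  have h4 : -(α * (b * s)⁻¹) * inner ℝ (x 0) (x 3) ≤ _ :=
    mul_real_inner_le (c' := |α| / (b * s₀)) (by
      rw [abs_neg, abs_mul, abs_of_pos (by positivity : 0 < (b * s)⁻¹), div_eq_mul_inv]
      gcongr) _ _
  have h5 : (α * s⁻¹) * inner ℝ (x 2) (x 1) ≤ _ :=
    mul_real_inner_le (c' := |α| / s₀) (by
      rw [abs_mul, abs_of_pos (by positivity : 0 < s⁻¹), div_eq_mul_inv]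
      gcongr) _ _
  rw [real_inner_comm] at h1
  have e1 : inner ℝ (x 1) (x 2) = inner ℝ (x 2) (x 1) := real_inner_comm _ _
  unfold multiplierDeriv
  rw [e1]
  simp only [div_pow, sq_abs] at h4 h5 h2 ⊢
  rw [div_pow] at hKα
  rw [div_pow] at h3
  have e2 := congrArg (· * ‖x 3‖ ^ 2) hKα
  simp only at e2
  nlinarith [sq_nonneg ‖x 3‖]

theorem le_exp_mul_of_hasDerivAt {f f' : ℝ → ℝ} {k : ℝ} (hf : ∀ t, HasDerivAt f (f' t) t)
    (hf' : ∀ t, f' t ≤ -k * f t) {t : ℝ} (ht : 0 ≤ t) : f t ≤ Real.exp (-k * t) * f 0 := by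
  have hd : ∀ t, HasDerivAt (fun t => Real.exp (k * t) * f t)
      (Real.exp (k * t) * (k * 1) * f t + Real.exp (k * t) * f' t) t := fun t =>
    (((hasDerivAt_id t).const_mul k).exp).mul (hf t)
  have hanti : Antitone fun t => Real.exp (k * t) * f t := by
    refine antitone_of_deriv_nonpos (fun t => (hd t).differentiableAt) fun t => ?_
    rw [(hd t).deriv]
    have := mul_le_mul_of_nonneg_left (hf' t) (Real.exp_pos (k * t)).le
    linarith
  have h := hanti ht
  simp only [mul_zero, Real.exp_zero, one_mul] at h
  have h2 : f t = Real.exp (-k * t) * (Real.exp (k * t) * f t) := by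
    rw [← mul_assoc, ← Real.exp_add]
    simp
  rw [h2]
  gcongr

/-- All modes decay exponentially, with constants depending only on the bounds relating `s`, `d`
and the rate `ω`. For `b = 1` the condition `(b ^ 2 - 1) ^ 2 * (ω * s ^ 2) ≤ C₂ * d` is void and
one may take `ω = d`; otherwise it forces `ω` to be of the order of `d / s ^ 2`. -/
theorem exists_mode_exp_decay {b α s₀ D C₁ C₂ : ℝ} (hb : 0 < b) (hα : α ≠ 0) (hs₀ : 0 < s₀)
    (hD : 0 < D) (hC₁ : 0 < C₁) (hC₂ : 0 ≤ C₂) :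
    ∃ κ : ℝ, 0 < κ ∧ ∀ s d ω : ℝ, s₀ ≤ s → 0 < d → d ≤ D → 0 < ω → ω ≤ C₁ * d →
      (b ^ 2 - 1) ^ 2 * (ω * s ^ 2) ≤ C₂ * d → ∀ (x : ModeSpace) (t : ℝ), 0 ≤ t →
      ‖flow (modeOp b s d α) t x‖ ^ 2 ≤ 4 * Real.exp (-(κ * ω) * t) * ‖x‖ ^ 2 := by
  obtain ⟨K, hK⟩ : ∃ K, K = couplingFactor b s₀ α := ⟨_, rfl⟩
  have hK0 : 0 ≤ K := by rw [hK, couplingFactor]; positivity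
  obtain ⟨C₀, hC₀⟩ : ∃ C₀, C₀ = (|K * α| * (1 + b) + (b * s₀)⁻¹ + s₀⁻¹) / 2 := ⟨_, rfl⟩
  obtain ⟨C₃, hC₃⟩ : ∃ C₃, C₃ = K * α ^ 2 + 1 + (|K * α| * D) ^ 2 + (D / (b * s₀)) ^ 2 +
    (α / s₀) ^ 2 := ⟨_, rfl⟩
  have hC₀0 : 0 < C₀ := by rw [hC₀]; positivity
  have hC₃0 : 0 < C₃ := by rw [hC₃]; positivity
  -- `ε` makes `‖x‖² + ε ω m` comparable to `‖x‖²`, and lets the dissipation absorb the `v`-terms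
  obtain ⟨ε, hε, hε1, hε2⟩ : ∃ ε : ℝ, 0 < ε ∧ ε * (C₁ * D * C₀) ≤ 1 / 2 ∧
      ε * (C₃ * C₁ + (K * α) ^ 2 * C₂) ≤ 1 := by
    refine ⟨min (1 / 2 / (C₁ * D * C₀)) (1 / (C₃ * C₁ + (K * α) ^ 2 * C₂)),
      by positivity, ?_, ?_⟩
    · rw [← le_div_iff₀ (by positivity)]
      exact min_le_left _ _
    · rw [← le_div_iff₀ (by positivity)]
      exact min_le_right _ _
  refine ⟨min (1 / C₁) (ε / 2) / 2, by positivity, ?_⟩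
  set κ := min (1 / C₁) (ε / 2) with hκ
  have hκ0 : 0 < κ := by positivity
  have hκ1 : κ * C₁ ≤ 1 := by
    rw [← le_div_iff₀ hC₁]
    exact min_le_left _ _
  have hκ2 : κ ≤ ε / 2 := min_le_right _ _
  intro s d ω hs hd hdD hω hωd hωs x t ht
  have hs' : 0 < s := hs₀.trans_le hs
  have hm : ∀ y, |ε * ω * multiplier b s α K y| ≤ ‖y‖ ^ 2 / 2 := by
    intro y
    have h := abs_multiplier_le α K hb hs₀ hs y
    rw [← hC₀] at h
    rw [abs_mul, abs_of_pos (by positivity : 0 < ε * ω)]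
    have hωD : ω ≤ C₁ * D := hωd.trans (by gcongr)
    calc _ ≤ ε * (C₁ * D) * (C₀ * ‖y‖ ^ 2) := by gcongr
      _ = ε * (C₁ * D * C₀) * ‖y‖ ^ 2 := by ring
      _ ≤ 1 / 2 * ‖y‖ ^ 2 := by gcongr
      _ = _ := by ring
  have hderiv := fun t => (hasDerivAt_norm_sq_flow b s d α x t).add
    ((hasDerivAt_multiplier (d := d) (α := α) hb.ne' hs'.ne' K x t).const_mul (ε * ω))
  have hle : ∀ t, -2 * d * ‖flow (modeOp b s d α) t x 1‖ ^ 2 +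
      ε * ω * multiplierDeriv b s d α K (flow (modeOp b s d α) t x) ≤
      -(κ / 2 * ω) * (‖flow (modeOp b s d α) t x‖ ^ 2 +
        ε * ω * multiplier b s α K (flow (modeOp b s d α) t x)) := by
    intro t
    generalize flow (modeOp b s d α) t x = y
    have h1 := multiplierDeriv_le hb hα hs₀ hs hd hdD y hK
    rw [← hC₃] at h1
    have h2 := mul_le_mul_of_nonneg_left h1 (by positivity : 0 ≤ ε * ω)
    have h3 := (le_abs_self _).trans (hm y)
    have hV := sq_nonneg ‖y 1‖
    have h4 : ε * (C₃ * ω + (K * α) ^ 2 * ((b ^ 2 - 1) ^ 2 * (ω * s ^ 2))) ≤ d := by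
      calc _ ≤ ε * (C₃ * (C₁ * d) + (K * α) ^ 2 * (C₂ * d)) := by gcongr
        _ = ε * (C₃ * C₁ + (K * α) ^ 2 * C₂) * d := by ring
        _ ≤ 1 * d := by gcongr
        _ = d := one_mul d
    have h5 := mul_le_mul_of_nonneg_right h4 hV
    have h6 : κ * ω ≤ d := by
      calc _ ≤ κ * (C₁ * d) := by gcongr
        _ = κ * C₁ * d := by ring
        _ ≤ 1 * d := by gcongr
        _ = d := one_mul d
    have h7 := mul_le_mul_of_nonneg_right h6 hV
    have h8 : κ * ω * (‖y 0‖ ^ 2 + ‖y 2‖ ^ 2 + ‖y 3‖ ^ 2) ≤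
        ε / 2 * ω * (‖y 0‖ ^ 2 + ‖y 2‖ ^ 2 + ‖y 3‖ ^ 2) := by gcongr
    have h9 := mul_le_mul_of_nonneg_left h3 (by positivity : 0 ≤ κ / 2 * ω)
    have h10 : 0 ≤ κ * ω * ‖y‖ ^ 2 := by positivity
    rw [modeSpace_norm_sq] at h9 h10 ⊢
    linarith
  have h := le_exp_mul_of_hasDerivAt hderiv hle ht
  simp only [Pi.add_apply, flow_zero, one_apply_eq_self] at h
  have h1 := neg_le_of_abs_le (hm (flow (modeOp b s d α) t x))
  have h2 := le_of_abs_le (hm x)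
  have h3 : ‖x‖ ^ 2 + ε * ω * multiplier b s α K x ≤ 2 * ‖x‖ ^ 2 := by
    linarith [sq_nonneg ‖x‖]
  have h4 := mul_le_mul_of_nonneg_left h3 (Real.exp_pos (-(κ / 2 * ω) * t)).le
  linarith

end Decay

/-! ### Polynomial decay of the modes -/

section Rate

/-- The order of magnitude of the decay rate of the slowest solution in the mode with
eigenvalue `l`. -/
noncomputable def modeRate (a γ l : ℝ) : ℝ := if a = 1 then l ^ γ else l ^ (γ - 1)

theorem modeRate_pos (a γ : ℝ) {l : ℝ} (hl : 0 < l) : 0 < modeRate a γ l := by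
  unfold modeRate
  split_ifs <;> positivity

theorem modeRate_mul {a : ℝ} (ha : a ≠ 1) (γ : ℝ) {l : ℝ} (hl : 0 < l) :
    modeRate a γ l * l = l ^ γ := by
  rw [modeRate, if_neg ha, Real.rpow_sub_one hl.ne']
  field_simp

theorem decayExponent_pos {a γ : ℝ} (haγ : (a = 1 ∧ γ < 0) ∨ (a ≠ 1 ∧ γ ≤ 0)) :
    0 < decayExponent a γ := by
  unfold decayExponent
  rcases haγ with ⟨ha, hγ⟩ | ⟨ha, hγ⟩
  · rw [if_pos ha]
    exact div_pos_of_neg_of_neg (by norm_num) hγ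
  · rw [if_neg ha]
    exact div_pos one_pos (by linarith)

/-- The exponent `δ(γ)` is the one for which `ω ^ δ = 1 / l`. -/
theorem modeRate_rpow_decayExponent {a γ : ℝ} (haγ : (a = 1 ∧ γ < 0) ∨ (a ≠ 1 ∧ γ ≤ 0)) {l : ℝ}
    (hl : 0 < l) : modeRate a γ l ^ decayExponent a γ = l⁻¹ := by
  unfold modeRate decayExponent
  rcases haγ with ⟨ha, hγ⟩ | ⟨ha, hγ⟩
  · rw [if_pos ha, if_pos ha, ← Real.rpow_mul hl.le, mul_div_cancel₀ _ hγ.ne, Real.rpow_neg_one]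
  · have h : 1 - γ ≠ 0 := by linarith
    rw [if_neg ha, if_neg ha, ← Real.rpow_mul hl.le, ← Real.rpow_neg_one]
    congr 1
    field_simp
    ring

/-- Boundedness of `y ^ p * e ^ (-k y)`. -/
theorem rpow_le_rpow_mul_exp {y p k : ℝ} (hy : 0 ≤ y) (hp : 0 < p) (hk : 0 < k) :
    y ^ p ≤ (p / k) ^ p * Real.exp (k * y) := by
  have h1 : k * y / p ≤ Real.exp (k * y / p) := by
    linarith [Real.add_one_le_exp (k * y / p)]
  have h2 : y = p / k * (k * y / p) := by field_simp
  calc y ^ p = (p / k) ^ p * (k * y / p) ^ p := by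
        rw [← Real.mul_rpow (by positivity) (by positivity), ← h2]
    _ ≤ (p / k) ^ p * Real.exp (k * y / p) ^ p := by gcongr
    _ = _ := by
        rw [← Real.exp_mul]
        congr 2
        field_simp

variable {c a γ α l : ℝ}

/-- The operator of the mode of the system with eigenvalue `l`. -/
noncomputable abbrev systemMode (a γ α l : ℝ) : ModeSpace →L[ℂ] ModeSpace :=
  modeOp √a √l (l ^ γ) α

theorem norm_apply_sq_le (x : ModeSpace) (i : Fin 4) : ‖x i‖ ^ 2 ≤ ‖x‖ ^ 2 := by
  have := PiLp.norm_apply_le x i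
  gcongr

theorem norm_ofReal_mul_sq (r : ℝ) (z : ℂ) : ‖(r : ℂ) * z‖ ^ 2 = r ^ 2 * ‖z‖ ^ 2 := by
  simp [mul_pow]

theorem norm_add_sq_le_two (z w : ℂ) : ‖z + w‖ ^ 2 ≤ 2 * ‖z‖ ^ 2 + 2 * ‖w‖ ^ 2 := by
  have h := norm_add_le z w
  calc _ ≤ (‖z‖ + ‖w‖) ^ 2 := by gcongr
    _ ≤ _ := by linarith [add_sq_le (a := ‖z‖) (b := ‖w‖)]

theorem norm_add_sq_le_three (z w u : ℂ) :
    ‖z + w + u‖ ^ 2 ≤ 3 * ‖z‖ ^ 2 + 3 * ‖w‖ ^ 2 + 3 * ‖u‖ ^ 2 := by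
  have h := norm_add₃_le (a := z) (b := w) (c := u)
  calc _ ≤ (‖z‖ + ‖w‖ + ‖u‖) ^ 2 := by gcongr
    _ ≤ _ := by
      linarith [sq_nonneg (‖z‖ - ‖w‖), sq_nonneg (‖z‖ - ‖u‖), sq_nonneg (‖w‖ - ‖u‖)]

/-- The inverse of the mode operator is of size `l ^ (-1/2)`. -/
theorem exists_norm_sq_le_systemMode (α : ℝ) (hc : 0 < c) (ha : 0 < a) (hγ : γ ≤ 0) :
    ∃ C : ℝ, 0 < C ∧ ∀ l, c ≤ l → ∀ x : ModeSpace,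
      ‖x‖ ^ 2 ≤ C / l * ‖systemMode a γ α l x‖ ^ 2 := by
  refine ⟨(3 + 3 * (c ^ γ) ^ 2 / (a * c) + 3 * α ^ 2 / c) / a + 1 / a + (2 * α ^ 2 / (a * c) + 2) +
    1, by positivity, fun l hl x => ?_⟩
  have hl0 : 0 < l := hc.trans_le hl
  have hd : l ^ γ ≤ c ^ γ := Real.rpow_le_rpow_of_nonpos hc hl hγ
  have hd0 : 0 < l ^ γ := by positivity
  have hsl : √l ^ 2 = l := Real.sq_sqrt hl0.le
  have hsa : (√a * √l) ^ 2 = a * l := by rw [mul_pow, hsl, Real.sq_sqrt ha.le]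
  generalize hw : systemMode a γ α l x = w
  have w0 : (√a * √l : ℝ) * x 1 = w 0 := by rw [← hw, modeOp_apply_zero]; push_cast; rfl
  have w1 : (√a * √l : ℝ) * x 0 = -(w 1 + (l ^ γ : ℝ) * x 1 + α * x 3) := by
    rw [← hw, modeOp_apply_one]; push_cast; ring
  have w2 : (√l : ℂ) * x 3 = w 2 := by rw [← hw, modeOp_apply_two]
  have w3 : (√l : ℂ) * x 2 = α * x 1 + -w 3 := by rw [← hw, modeOp_apply_three]; ring
  have n0 := norm_ofReal_mul_sq (√a * √l) (x 1)
  have n1 := norm_ofReal_mul_sq (√a * √l) (x 0)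
  have n2 := norm_ofReal_mul_sq √l (x 3)
  have n3 := norm_ofReal_mul_sq √l (x 2)
  rw [w0, hsa] at n0
  rw [w1, hsa, norm_neg] at n1
  rw [w2, hsl] at n2
  rw [w3, hsl] at n3
  have h1 := norm_add_sq_le_three (w 1) ((l ^ γ : ℝ) * x 1) (α * x 3)
  have h3 := norm_add_sq_le_two (α * x 1) (-w 3)
  rw [norm_ofReal_mul_sq, norm_ofReal_mul_sq, n1] at h1
  rw [norm_ofReal_mul_sq, n3, norm_neg] at h3
  have q0 := norm_apply_sq_le w 0
  have q1 := norm_apply_sq_le w 1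
  have q2 := norm_apply_sq_le w 2
  have q3 := norm_apply_sq_le w 3
  have hdd : (l ^ γ) ^ 2 * ‖x 1‖ ^ 2 ≤ (c ^ γ) ^ 2 * ‖x 1‖ ^ 2 := by gcongr
  rw [modeSpace_norm_sq x]
  generalize ‖w‖ ^ 2 = N at *
  have b1 : ‖x 1‖ ^ 2 ≤ N / (a * c) := by
    rw [le_div_iff₀ (by positivity)]
    calc _ = a * c * ‖x 1‖ ^ 2 := by ring
      _ ≤ a * l * ‖x 1‖ ^ 2 := by gcongr
      _ ≤ N := n0 ▸ q0
  have b3 : ‖x 3‖ ^ 2 ≤ N / c := by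
    rw [le_div_iff₀ hc]
    calc _ = c * ‖x 3‖ ^ 2 := by ring
      _ ≤ l * ‖x 3‖ ^ 2 := by gcongr
      _ ≤ N := n2 ▸ q2
  have m1 : l * ‖x 1‖ ^ 2 ≤ N / a := by
    rw [le_div_iff₀ ha]
    linarith
  have m0 : l * ‖x 0‖ ^ 2 ≤
      (3 * N + 3 * (c ^ γ) ^ 2 * (N / (a * c)) + 3 * α ^ 2 * (N / c)) / a := by
    rw [le_div_iff₀ ha]
    have e1 : 3 * (c ^ γ) ^ 2 * ‖x 1‖ ^ 2 ≤ 3 * (c ^ γ) ^ 2 * (N / (a * c)) := by gcongr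
    have e2 : 3 * α ^ 2 * ‖x 3‖ ^ 2 ≤ 3 * α ^ 2 * (N / c) := by gcongr
    linarith
  have m2 : l * ‖x 2‖ ^ 2 ≤ 2 * α ^ 2 * (N / (a * c)) + 2 * N := by
    have e1 : 2 * α ^ 2 * ‖x 1‖ ^ 2 ≤ 2 * α ^ 2 * (N / (a * c)) := by gcongr
    linarith
  rw [div_mul_eq_mul_div, le_div_iff₀ hl0]
  calc _ = l * ‖x 0‖ ^ 2 + l * ‖x 1‖ ^ 2 + l * ‖x 2‖ ^ 2 + l * ‖x 3‖ ^ 2 := by ring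
    _ ≤ _ := add_le_add (add_le_add (add_le_add m0 m1) m2) (n2 ▸ q2)
    _ = _ := by ring

theorem modeRate_le (hc : 0 < c) (hl : c ≤ l) : modeRate a γ l ≤ (1 + c⁻¹) * l ^ γ := by
  have hl0 : 0 < l := hc.trans_le hl
  unfold modeRate
  split_ifs
  · linarith [mul_pos (inv_pos.2 hc) (Real.rpow_pos_of_pos hl0 γ)]
  · rw [Real.rpow_sub_one hl0.ne', div_eq_inv_mul]
    have : l⁻¹ ≤ 1 + c⁻¹ := by
      have : l⁻¹ ≤ c⁻¹ := by gcongr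
      linarith
    gcongr

/-- The polynomial decay of the energy of all modes, with a uniform constant. -/
theorem exists_systemMode_decay (hc : 0 < c) (ha : 0 < a) (hα : α ≠ 0)
    (haγ : (a = 1 ∧ γ < 0) ∨ (a ≠ 1 ∧ γ ≤ 0)) :
    ∃ C : ℝ, 0 < C ∧ ∀ l, c ≤ l → ∀ t, 0 < t → ∀ x : ModeSpace,
      ‖flow (systemMode a γ α l) t x‖ ^ 2 ≤
        C / t ^ decayExponent a γ * ‖systemMode a γ α l x‖ ^ 2 := by
  have hγ : γ ≤ 0 := by rcases haγ with h | h <;> linarith [h.2]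
  obtain ⟨κ, hκ, H⟩ := exists_mode_exp_decay (b := √a) (α := α) (s₀ := √c) (D := c ^ γ)
    (C₁ := 1 + c⁻¹) (C₂ := (a - 1) ^ 2) (by positivity) hα (by positivity) (by positivity)
    (by positivity) (by positivity)
  have hδ := decayExponent_pos haγ
  set δ := decayExponent a γ with hδdef
  obtain ⟨C', hC'0, hC'⟩ := exists_norm_sq_le_systemMode α hc ha hγ
  refine ⟨4 * (δ / κ) ^ δ * C', by positivity, fun l hl t ht x => ?_⟩
  have hl0 : 0 < l := hc.trans_le hl
  have hω := modeRate_pos a γ hl0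
  have h1 := H √l (l ^ γ) (modeRate a γ l) (by gcongr) (by positivity)
    (Real.rpow_le_rpow_of_nonpos hc hl hγ) hω (modeRate_le hc hl) (by
      rw [Real.sq_sqrt ha.le, Real.sq_sqrt hl0.le]
      by_cases h : a = 1
      · simp [h]
      · rw [modeRate_mul h γ hl0]) x t ht.le
  have h2 := hC' l hl x
  have h3 := rpow_le_rpow_mul_exp (y := modeRate a γ l * t) (p := δ) (k := κ)
    (by positivity) hδ hκ
  rw [Real.mul_rpow hω.le ht.le, modeRate_rpow_decayExponent haγ hl0] at h3
  have h4 : Real.exp (-(κ * modeRate a γ l) * t) * l⁻¹ ≤ (δ / κ) ^ δ / t ^ δ := by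
    rw [le_div_iff₀ (by positivity)]
    calc _ = Real.exp (-(κ * modeRate a γ l) * t) * (l⁻¹ * t ^ δ) := by ring
      _ ≤ Real.exp (-(κ * modeRate a γ l) * t) *
          ((δ / κ) ^ δ * Real.exp (κ * (modeRate a γ l * t))) := by gcongr
      _ = (δ / κ) ^ δ * Real.exp (-(κ * modeRate a γ l) * t + κ * (modeRate a γ l * t)) := by
          rw [Real.exp_add]; ring
      _ = _ := by
          rw [show -(κ * modeRate a γ l) * t + κ * (modeRate a γ l * t) = 0 by ring]
          simp
  calc _ ≤ _ := h1
    _ ≤ 4 * Real.exp (-(κ * modeRate a γ l) * t) * (C' / l * ‖systemMode a γ α l x‖ ^ 2) := by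
        gcongr
    _ = 4 * C' * (Real.exp (-(κ * modeRate a γ l) * t) * l⁻¹) * ‖systemMode a γ α l x‖ ^ 2 := by
        ring
    _ ≤ 4 * C' * ((δ / κ) ^ δ / t ^ δ) * ‖systemMode a γ α l x‖ ^ 2 := by gcongr
    _ = _ := by ring

end Rate

/-! ### Slowly decaying modes -/

section Slow

/-- The undamped mode operator is skew-adjoint; the damping contributes a term in `v` only. -/
theorem inner_modeOp (b s d α : ℝ) (x y : ModeSpace) :
    inner ℂ x (modeOp b s d α y) =
      -inner ℂ (modeOp b s 0 α x) y - d * inner ℂ (x 1) (y 1) := by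
  simp only [PiLp.inner_apply, Fin.sum_univ_four, modeOp_apply_zero, modeOp_apply_one,
    modeOp_apply_two, modeOp_apply_three]
  simp
  ring

/-- If `x` is an eigenvector of the undamped mode operator whose `v`-component is small, then the
orbit of `x` under the damped flow stays of the size of `x` up to the time `1 / η`. The quantity
`Re ⟨e^(iβt) x, e^(tM) x⟩` changes at most at the rate `d |v_x| |v(t)|`, and the dissipation law
bounds the integral of `d |v(t)|²`. -/
theorem norm_le_norm_flow_of_eigenvector {b s d α β η : ℝ} (hd : 0 ≤ d) (hη : 0 < η)
    {x : ModeSpace} (hx : modeOp b s 0 α x = (β * Complex.I) • x)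
    (hv : d * ‖x 1‖ ^ 2 ≤ η * ‖x‖ ^ 2) :
    ‖x‖ / 4 ≤ ‖flow (modeOp b s d α) η⁻¹ x‖ := by
  let X : ℝ → ModeSpace := fun t => flow (modeOp b s d α) t x
  let e : ℝ → ℂ := fun t => Complex.exp (-(t * (β * Complex.I)))
  have he : ∀ t, HasDerivAt e (e t * -(1 * (β * Complex.I))) t := fun t =>
    ((((hasDerivAt_id (t : ℂ)).comp_ofReal).mul_const (β * Complex.I)).neg).cexp
  have hnorm : ∀ t, ‖e t‖ = 1 := fun t => by
    have : -((t : ℂ) * (β * Complex.I)) = ((-(t * β) : ℝ) : ℂ) * Complex.I := by push_cast; ring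
    simp only [e, this, Complex.norm_exp_ofReal_mul_I]
  have hX : ∀ t, HasDerivAt (fun t => inner ℂ x (X t)) (inner ℂ x (modeOp b s d α (X t))) t :=
    fun t => ((innerSL ℂ x).restrictScalars ℝ).hasFDerivAt.comp_hasDerivAt t
      (hasDerivAt_flow (modeOp b s d α) x t)
  have hprod : ∀ t, HasDerivAt (fun t => (e t * inner ℂ x (X t)).re)
      (-(d * (e t * inner ℂ (x 1) (X t 1)).re)) t := by
    intro t
    have h := (he t).mul (hX t)
    have h2 := Complex.reCLM.hasFDerivAt.comp_hasDerivAt t h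
    refine h2.congr_deriv ?_
    rw [inner_modeOp, hx, inner_smul_left, Complex.reCLM_apply, ← Complex.re_ofReal_mul,
      ← Complex.neg_re]
    congr 1
    simp
    ring
  have hφ : ∀ t, HasDerivAt
      (fun t => (e t * inner ℂ x (X t)).re - 1 / 2 * ‖X t‖ ^ 2 + t * (η * ‖x‖ ^ 2 / 4))
      (-(d * (e t * inner ℂ (x 1) (X t 1)).re) - 1 / 2 * (-2 * d * ‖X t 1‖ ^ 2) +
        1 * (η * ‖x‖ ^ 2 / 4)) t := fun t =>
    ((hprod t).sub ((hasDerivAt_norm_sq_flow b s d α x t).const_mul (1 / 2))).add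
      ((hasDerivAt_id t).mul_const _)
  have hmono : Monotone
      (fun t => (e t * inner ℂ x (X t)).re - 1 / 2 * ‖X t‖ ^ 2 + t * (η * ‖x‖ ^ 2 / 4)) := by
    refine monotone_of_deriv_nonneg (fun t => (hφ t).differentiableAt) fun t => ?_
    rw [(hφ t).deriv]
    have h1 : (e t * inner ℂ (x 1) (X t 1)).re ≤ ‖x 1‖ * ‖X t 1‖ := by
      refine (Complex.re_le_norm _).trans ?_
      rw [norm_mul, hnorm, one_mul]
      exact norm_inner_le_norm _ _
    have h2 := mul_le_mul_of_nonneg_left h1 hd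
    have h3 : 0 ≤ d * (‖X t 1‖ - ‖x 1‖ / 2) ^ 2 := by positivity
    nlinarith
  have h := hmono (inv_pos.2 hη).le
  have h0 : X 0 = x := by simp [X, flow_zero]
  have he0 : e 0 = 1 := by simp [e]
  simp only [h0, he0, one_mul, zero_mul, add_zero] at h
  have hxx : (inner ℂ x x).re = ‖x‖ ^ 2 := by
    rw [inner_self_eq_norm_sq_to_K]
    norm_cast
  have h4 : η⁻¹ * (η * ‖x‖ ^ 2 / 4) = ‖x‖ ^ 2 / 4 := by field_simp
  have h5 : (e η⁻¹ * inner ℂ x (X η⁻¹)).re ≤ ‖x‖ * ‖X η⁻¹‖ := by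
    refine (Complex.re_le_norm _).trans ?_
    rw [norm_mul, hnorm, one_mul]
    exact norm_inner_le_norm _ _
  rw [hxx, h4] at h
  have h6 : ‖x‖ * (‖x‖ / 4) ≤ ‖x‖ * ‖X η⁻¹‖ := by nlinarith [sq_nonneg ‖X η⁻¹‖]
  rcases (norm_nonneg x).eq_or_lt with hx0 | hx0
  · rw [← hx0]
    simp
  · exact le_of_mul_le_mul_left h6 hx0

/-- A squared frequency of the undamped mode, close to the eigenvalue `l` when `a ≠ 1`. -/
theorem exists_frequency {a α l : ℝ} (ha : 0 < a) (hα : α ≠ 0) (hl : 0 < l) :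
    ∃ σ : ℝ, 0 < σ ∧ (a * l - σ) * (l - σ) = α ^ 2 * σ ∧
      (1 - a) ^ 2 * (σ * l) ≤ (a * l - σ) ^ 2 := by
  obtain ⟨p, hp⟩ : ∃ p, p = ((a + 1) * l + α ^ 2) / 2 := ⟨_, rfl⟩
  have hp0 : 0 < p := by rw [hp]; positivity
  have hα2 : 0 < α ^ 2 := by positivity
  have hdisc : (l - p) ^ 2 < p ^ 2 - a * l ^ 2 := by
    rw [hp]
    nlinarith [mul_pos hα2 hl]
  have hd0 : 0 ≤ p ^ 2 - a * l ^ 2 := (sq_nonneg _).trans hdisc.le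
  obtain ⟨r, hr⟩ : ∃ r, r = √(p ^ 2 - a * l ^ 2) := ⟨_, rfl⟩
  have hr0 : 0 ≤ r := hr ▸ Real.sqrt_nonneg _
  have hr2 : r ^ 2 = p ^ 2 - a * l ^ 2 := by rw [hr, Real.sq_sqrt hd0]
  have habs : |l - p| < r := abs_lt_of_sq_lt_sq (by rw [hr2]; exact hdisc) hr0
  obtain ⟨h1, h2⟩ := abs_lt.1 habs
  have hrp : r < p := by
    refine lt_of_pow_lt_pow_left₀ 2 hp0.le ?_
    rw [hr2]
    have : 0 < a * l ^ 2 := by positivity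
    linarith
  rcases le_or_gt a 1 with ha1 | ha1
  · -- the larger root is at least `l`
    refine ⟨p + r, by linarith, by nlinarith, ?_⟩
    have hlσ : l ≤ p + r := by linarith
    generalize p + r = σ at *
    have h3 : (1 - a) * σ ≤ σ - a * l := by nlinarith
    have h4 : 0 ≤ 1 - a := by linarith
    have hσ : 0 < σ := hl.trans_le hlσ
    calc (1 - a) ^ 2 * (σ * l) ≤ (1 - a) ^ 2 * (σ * σ) := by gcongr
      _ = ((1 - a) * σ) ^ 2 := by ring
      _ ≤ (σ - a * l) ^ 2 := by gcongr
      _ = _ := by ring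
  · -- the smaller root is at most `l`
    refine ⟨p - r, by linarith, by nlinarith, ?_⟩
    have hlσ : p - r ≤ l := by linarith
    have hσ : 0 < p - r := by linarith
    generalize p - r = σ at *
    have h4 : 0 ≤ a - 1 := by linarith
    calc (1 - a) ^ 2 * (σ * l) ≤ (1 - a) ^ 2 * (l * l) := by gcongr
      _ = ((a - 1) * l) ^ 2 := by ring
      _ ≤ (a * l - σ) ^ 2 := by
        gcongr
        linarith

variable {a γ α c : ℝ}

theorem exists_slow_orbit (ha : 0 < a) (hα : α ≠ 0) :
    ∃ C : ℝ, 0 < C ∧ ∀ l, 0 < l → ∃ x : ModeSpace, x ≠ 0 ∧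
      ‖x‖ / 4 ≤ ‖flow (systemMode a γ α l) (C * modeRate a γ l)⁻¹ x‖ := by
  refine ⟨1 + α ^ 2 / (1 - a) ^ 2, by positivity, fun l hl => ?_⟩
  obtain ⟨σ, hσ, hroot, hfreq⟩ := exists_frequency ha hα hl
  obtain ⟨m, hm⟩ : ∃ m, m = a * l - σ := ⟨_, rfl⟩
  have hω := modeRate_pos a γ hl
  have hσs : (√σ : ℂ) * √σ = σ := by rw [← Complex.ofReal_mul, Real.mul_self_sqrt hσ.le]
  have hls : (√l : ℂ) * √l = l := by rw [← Complex.ofReal_mul, Real.mul_self_sqrt hl.le]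
  have has : (√a : ℂ) * √a = a := by rw [← Complex.ofReal_mul, Real.mul_self_sqrt ha.le]
  have hI := Complex.I_mul_I
  have hroot' : (m : ℂ) * (l - σ) = α ^ 2 * σ := by
    rw [← hm] at hroot
    exact_mod_cast hroot
  have hm' : (m : ℂ) = a * l - σ := by exact_mod_cast congrArg Complex.ofReal hm
  let x : ModeSpace := !₂[-(√a * √l * α * √σ * Complex.I : ℂ), (α * σ : ℂ), (√l * m : ℂ),
    (√σ * m * Complex.I : ℂ)]
  have x0 : x 0 = -(√a * √l * α * √σ * Complex.I : ℂ) := rfl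
  have x1 : x 1 = (α * σ : ℂ) := rfl
  have x2 : x 2 = (√l * m : ℂ) := rfl
  have x3 : x 3 = (√σ * m * Complex.I : ℂ) := rfl
  have n1 : ‖x 1‖ ^ 2 = (α * σ) ^ 2 := by
    rw [x1, ← Complex.ofReal_mul, Complex.norm_real, Real.norm_eq_abs, sq_abs]
  have n3 : ‖x 3‖ ^ 2 = σ * m ^ 2 := by
    rw [x3, ← Complex.ofReal_mul, norm_mul, Complex.norm_I, mul_one, Complex.norm_real,
      Real.norm_eq_abs, sq_abs, mul_pow, Real.sq_sqrt hσ.le]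
  refine ⟨x, ?_, norm_le_norm_flow_of_eigenvector (β := √σ) (by positivity) (by positivity) ?_ ?_⟩
  · intro h
    have : ‖x 1‖ ^ 2 = 0 := by rw [h]; simp
    rw [n1] at this
    have h2 : (0 : ℝ) < (α * σ) ^ 2 := by positivity
    exact h2.ne' this
  · ext i
    fin_cases i
    · simp only [Fin.zero_eta, modeOp_apply_zero, PiLp.smul_apply, smul_eq_mul, x0, x1]
      linear_combination -(√a * √l * α : ℂ) * hσs + (√σ * √σ * √a * √l * α : ℂ) * hI
    · simp only [Fin.mk_one, modeOp_apply_one, PiLp.smul_apply, smul_eq_mul, x0, x1, x3]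
      push_cast
      rw [hm']
      linear_combination (√l * √l * α * √σ * Complex.I) * has + (a * α * √σ * Complex.I) * hls
    · simp only [Fin.reduceFinMk, modeOp_apply_two, PiLp.smul_apply, smul_eq_mul, x2, x3]
      ring
    · simp only [Fin.reduceFinMk, modeOp_apply_three, PiLp.smul_apply, smul_eq_mul, x1, x2, x3]
      linear_combination -(m : ℂ) * hls - (√σ * √σ * m : ℂ) * hI + (m : ℂ) * hσs - hroot'
  · have hle1 := norm_apply_sq_le x 1
    have hle3 := norm_apply_sq_le x 3
    unfold modeRate
    split_ifs with h1
    · have : 0 ≤ α ^ 2 / (1 - a) ^ 2 * l ^ γ * ‖x‖ ^ 2 := by positivity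
      have h2 : l ^ γ * ‖x 1‖ ^ 2 ≤ l ^ γ * ‖x‖ ^ 2 := by gcongr
      linarith
    · have h1a : 0 < (1 - a) ^ 2 := by
        have : 1 - a ≠ 0 := sub_ne_zero.2 (Ne.symm h1)
        positivity
      have key : ‖x 1‖ ^ 2 * l ≤ α ^ 2 / (1 - a) ^ 2 * ‖x‖ ^ 2 := by
        rw [div_mul_eq_mul_div, le_div_iff₀ h1a, n1]
        calc _ = α ^ 2 * σ * ((1 - a) ^ 2 * (σ * l)) := by ring
          _ ≤ α ^ 2 * σ * m ^ 2 := by rw [hm]; gcongr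
          _ = α ^ 2 * ‖x 3‖ ^ 2 := by rw [n3]; ring
          _ ≤ _ := by gcongr
      rw [Real.rpow_sub_one hl.ne']
      calc l ^ γ * ‖x 1‖ ^ 2 = l ^ γ / l * (‖x 1‖ ^ 2 * l) := by field_simp
        _ ≤ l ^ γ / l * (α ^ 2 / (1 - a) ^ 2 * ‖x‖ ^ 2) := by gcongr
        _ ≤ l ^ γ / l * ((1 + α ^ 2 / (1 - a) ^ 2) * ‖x‖ ^ 2) := by
          gcongr
          linarith
        _ = _ := by ring

theorem exists_norm_systemMode_sq_le (α : ℝ) (hc : 0 < c) (ha : 0 < a) (hγ : γ ≤ 0) :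
    ∃ C : ℝ, 0 < C ∧ ∀ l, c ≤ l → ∀ x : ModeSpace,
      ‖systemMode a γ α l x‖ ^ 2 ≤ C * l * ‖x‖ ^ 2 := by
  refine ⟨4 * a + 3 + (3 * (c ^ γ) ^ 2 + 5 * α ^ 2) / c, by positivity, fun l hl x => ?_⟩
  have hl0 : 0 < l := hc.trans_le hl
  have hd : l ^ γ ≤ c ^ γ := Real.rpow_le_rpow_of_nonpos hc hl hγ
  have hsl : √l ^ 2 = l := Real.sq_sqrt hl0.le
  have hsa : (√a * √l) ^ 2 = a * l := by rw [mul_pow, hsl, Real.sq_sqrt ha.le]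
  have n0 : ‖systemMode a γ α l x 0‖ ^ 2 = a * l * ‖x 1‖ ^ 2 := by
    rw [modeOp_apply_zero, ← Complex.ofReal_mul, norm_ofReal_mul_sq, hsa]
  have n1 : ‖systemMode a γ α l x 1‖ ^ 2 ≤
      3 * (a * l * ‖x 0‖ ^ 2) + 3 * ((l ^ γ) ^ 2 * ‖x 1‖ ^ 2) + 3 * (α ^ 2 * ‖x 3‖ ^ 2) := by
    have h := norm_add_sq_le_three ((√a * √l : ℝ) * x 0) ((l ^ γ : ℝ) * x 1) (α * x 3)
    rw [norm_ofReal_mul_sq, norm_ofReal_mul_sq, norm_ofReal_mul_sq, hsa, ← norm_neg] at h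
    refine le_trans (le_of_eq ?_) h
    rw [modeOp_apply_one]
    congr 2
    push_cast
    ring
  have n2 : ‖systemMode a γ α l x 2‖ ^ 2 = l * ‖x 3‖ ^ 2 := by
    rw [modeOp_apply_two, norm_ofReal_mul_sq, hsl]
  have n3 : ‖systemMode a γ α l x 3‖ ^ 2 ≤ 2 * (l * ‖x 2‖ ^ 2) + 2 * (α ^ 2 * ‖x 1‖ ^ 2) := by
    have h := norm_add_sq_le_two (-(√l * x 2)) (α * x 1)
    rw [norm_neg, norm_ofReal_mul_sq, norm_ofReal_mul_sq, hsl] at h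
    rwa [modeOp_apply_three, neg_mul]
  have q0 : a * l * ‖x 0‖ ^ 2 ≤ a * l * ‖x‖ ^ 2 := by gcongr; exact PiLp.norm_apply_le x 0
  have q1 : a * l * ‖x 1‖ ^ 2 ≤ a * l * ‖x‖ ^ 2 := by gcongr; exact PiLp.norm_apply_le x 1
  have q1' : (l ^ γ) ^ 2 * ‖x 1‖ ^ 2 ≤ (c ^ γ) ^ 2 * ‖x‖ ^ 2 := by
    gcongr; exact PiLp.norm_apply_le x 1
  have q1'' : α ^ 2 * ‖x 1‖ ^ 2 ≤ α ^ 2 * ‖x‖ ^ 2 := by gcongr; exact PiLp.norm_apply_le x 1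
  have q2 : l * ‖x 2‖ ^ 2 ≤ l * ‖x‖ ^ 2 := by gcongr; exact PiLp.norm_apply_le x 2
  have q3 : l * ‖x 3‖ ^ 2 ≤ l * ‖x‖ ^ 2 := by gcongr; exact PiLp.norm_apply_le x 3
  have q3' : α ^ 2 * ‖x 3‖ ^ 2 ≤ α ^ 2 * ‖x‖ ^ 2 := by gcongr; exact PiLp.norm_apply_le x 3
  have hlc : 3 * (c ^ γ) ^ 2 + 5 * α ^ 2 ≤ (3 * (c ^ γ) ^ 2 + 5 * α ^ 2) / c * l := by
    rw [div_mul_eq_mul_div, le_div_iff₀ hc]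
    gcongr
  have hlc' := mul_le_mul_of_nonneg_right hlc (sq_nonneg ‖x‖)
  rw [modeSpace_norm_sq (systemMode a γ α l x), n0, n2]
  linarith

/-- A decay faster than `t ^ (-δ(γ))`, with a given constant, is possible for bounded
eigenvalues only. -/
theorem exists_le_of_systemMode_decay (hc : 0 < c) (ha : 0 < a) (hα : α ≠ 0)
    (haγ : (a = 1 ∧ γ < 0) ∨ (a ≠ 1 ∧ γ ≤ 0)) {ε : ℝ} (hε : 0 < ε) {C : ℝ} (hC : 0 < C) :
    ∃ L : ℝ, ∀ l, c ≤ l → (∀ t, 0 < t → ∀ x : ModeSpace,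
      ‖flow (systemMode a γ α l) t x‖ ^ 2 ≤
        C / t ^ (decayExponent a γ + ε) * ‖systemMode a γ α l x‖ ^ 2) → l ≤ L := by
  have hγ : γ ≤ 0 := by rcases haγ with h | h <;> linarith [h.2]
  have hδ := decayExponent_pos haγ
  obtain ⟨C₁, hC₁, h₁⟩ := exists_slow_orbit (γ := γ) ha hα
  obtain ⟨C₂, hC₂, h₂⟩ := exists_norm_systemMode_sq_le α hc ha hγ
  set δ := decayExponent a γ with hδdef
  obtain ⟨K, hK⟩ : ∃ K, K = 16 * C * C₁ ^ (δ + ε) * C₂ := ⟨_, rfl⟩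
  have hK0 : 0 < K := by rw [hK]; positivity
  refine ⟨(((1 / K) ^ (1 / ε)) ^ δ)⁻¹, fun l hl h => ?_⟩
  have hl0 : 0 < l := hc.trans_le hl
  have hω := modeRate_pos a γ hl0
  have hωδ := modeRate_rpow_decayExponent haγ hl0
  rw [← hδdef] at hωδ
  obtain ⟨x, hx, hslow⟩ := h₁ l hl0
  generalize modeRate a γ l = ω at *
  have hx0 : 0 < ‖x‖ ^ 2 := by positivity
  have h3 : ‖x‖ ^ 2 / 16 ≤ C * (C₁ * ω) ^ (δ + ε) * (C₂ * l * ‖x‖ ^ 2) := by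
    calc ‖x‖ ^ 2 / 16 = (‖x‖ / 4) ^ 2 := by ring
      _ ≤ ‖flow (systemMode a γ α l) (C₁ * ω)⁻¹ x‖ ^ 2 := by gcongr
      _ ≤ _ := h _ (by positivity) x
      _ ≤ C / (C₁ * ω)⁻¹ ^ (δ + ε) * (C₂ * l * ‖x‖ ^ 2) := by
        gcongr
        exact h₂ l hl x
      _ = _ := by rw [Real.inv_rpow (by positivity), div_inv_eq_mul]
  have h4 : C * (C₁ * ω) ^ (δ + ε) * (C₂ * l * ‖x‖ ^ 2) = K / 16 * ω ^ ε * ‖x‖ ^ 2 := by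
    rw [Real.mul_rpow hC₁.le hω.le, Real.rpow_add hω, hωδ, hK]
    field_simp
  rw [h4] at h3
  have h5 : 1 / K ≤ ω ^ ε := by
    rw [div_le_iff₀ hK0]
    have : ‖x‖ ^ 2 * 1 ≤ ‖x‖ ^ 2 * (ω ^ ε * K) := by linarith
    exact le_of_mul_le_mul_left this hx0
  have h6 : (1 / K) ^ (1 / ε) ≤ ω := by
    calc _ ≤ (ω ^ ε) ^ (1 / ε) := by gcongr
      _ = ω := by rw [← Real.rpow_mul hω.le, mul_one_div_cancel hε.ne', Real.rpow_one]
  have h7 : ((1 / K) ^ (1 / ε)) ^ δ ≤ l⁻¹ := hωδ ▸ by gcongr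
  rwa [le_inv_comm₀ hl0 (by positivity)]

end Slow

/-! ### The spectral decomposition of `A` -/

section Spectral

variable {H : Type*} [NormedAddCommGroup H] [InnerProductSpace ℂ H]

theorem IsCoercive.injective {A : H →ₗ.[ℂ] H} (hc : IsCoercive A) {u v : A.domain}
    (h : A u = A v) : u = v := by
  obtain ⟨c, hc0, hc⟩ := hc
  have h1 := hc (u - v)
  rw [A.map_sub, h, sub_self, inner_zero_left, Complex.zero_re] at h1
  have h2 : ‖((u - v : A.domain) : H)‖ ^ 2 ≤ 0 := by
    by_contra hcon
    push Not at hcon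
    exact absurd h1 (not_le.2 (by positivity))
  have h3 : ((u - v : A.domain) : H) = 0 := by
    rw [← norm_eq_zero]
    exact pow_eq_zero_iff two_ne_zero |>.1 (le_antisymm h2 (by positivity))
  exact sub_eq_zero.1 (Subtype.ext h3)

variable {A : H →ₗ.[ℂ] H}

theorem eigenspace_le_span (hsimple : HasSimpleSpectrum A) {l : ℂ} {e : H}
    (he : e ∈ eigenspace A l) (he0 : e ≠ 0) {y : H} (hy : y ∈ eigenspace A l) :
    y ∈ Submodule.span ℂ {e} := by
  obtain ⟨v, hv⟩ := rank_le_one_iff.1 (hsimple l)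
  obtain ⟨r, hr⟩ := hv ⟨e, he⟩
  obtain ⟨s, hs⟩ := hv ⟨y, hy⟩
  have hr' : r • (v : H) = e := congrArg Subtype.val hr
  have hs' : s • (v : H) = y := congrArg Subtype.val hs
  have hr0 : r ≠ 0 := by
    rintro rfl
    exact he0 (by rw [← hr', zero_smul])
  rw [Submodule.mem_span_singleton]
  refine ⟨s * r⁻¹, ?_⟩
  rw [← hr', smul_smul, mul_assoc, inv_mul_cancel₀ hr0, mul_one, hs']

/-- The real eigenvalues of `A`; they index the eigenbasis of `A`. -/
abbrev EigenIndex (A : H →ₗ.[ℂ] H) : Type := {l : ℝ // eigenspace A (l : ℂ) ≠ ⊥}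

theorem exists_le_eigenIndex (hcoer : IsCoercive A) :
    ∃ c : ℝ, 0 < c ∧ ∀ i : EigenIndex A, c ≤ i.1 := by
  obtain ⟨c, hc0, hc⟩ := hcoer
  refine ⟨c, hc0, fun i => ?_⟩
  obtain ⟨u, ⟨hu, hu'⟩, hu0⟩ := Submodule.exists_mem_ne_zero_of_ne_bot i.2
  have h := hc ⟨u, hu⟩
  rw [hu', inner_smul_left, inner_self_eq_norm_sq_to_K] at h
  have hn : 0 < ‖u‖ ^ 2 := by positivity
  have h' : c * ‖u‖ ^ 2 ≤ i.1 * ‖u‖ ^ 2 := by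
    simpa [← Complex.ofReal_pow, ← Complex.ofReal_mul] using h
  exact le_of_mul_le_mul_right h' hn

theorem exists_repr_eq {ι : Type*} (b : HilbertBasis ι ℂ H) {f : ι → ℂ}
    (hf : Summable fun i => ‖f i‖ ^ 2) : ∃ w : H, ∀ i, b.repr w i = f i :=
  ⟨b.repr.symm ⟨f, memℓp_two_iff.2 hf⟩, fun i => by simp⟩

theorem norm_sq_eq_tsum_repr {ι : Type*} (b : HilbertBasis ι ℂ H) (u : H) :
    ‖u‖ ^ 2 = ∑' i, ‖b.repr u i‖ ^ 2 := by
  rw [← b.repr.norm_map u, norm_sq_eq_tsum]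

theorem ext_repr {ι : Type*} (b : HilbertBasis ι ℂ H) {u v : H}
    (h : ∀ i, b.repr u i = b.repr v i) : u = v :=
  b.repr.injective (lp.ext (funext h))

variable [CompleteSpace H]

theorem inner_map_symm (hA : IsSelfAdjoint A) (x y : A.domain) :
    inner ℂ (A x) (y : H) = inner ℂ (x : H) (A y) := by
  have h := A.adjoint_isFormalAdjoint hA.dense_domain
  rw [LinearPMap.isSelfAdjoint_def.mp hA] at h
  exact h x y

/-- The inverse of `A` is compact: `-1 / l` is not an eigenvalue of the compact operator
`R = (A - l)⁻¹` because `A` is injective, so that `1 + l R` is invertible by the Fredholm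
alternative, and `A⁻¹ = R (1 + l R)⁻¹`. -/
theorem exists_compact_inverse (hcoer : IsCoercive A) (hcomp : HasCompactResolvent A) :
    ∃ T : H →L[ℂ] H, IsCompactOperator T ∧
      ∀ f : H, ∃ h : T f ∈ A.domain, A ⟨T f, h⟩ = f := by
  obtain ⟨l, R, hR, hAR, -⟩ := hcomp
  by_cases hl : l = 0
  · refine ⟨R, hR, fun f => ?_⟩
    obtain ⟨h1, h2⟩ := hAR f
    exact ⟨h1, by simpa [hl] using h2⟩
  have hμ : -l⁻¹ ≠ 0 := neg_ne_zero.2 (inv_ne_zero hl)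
  rcases hR.hasEigenvalue_or_mem_resolventSet hμ with hev | hres
  · exfalso
    obtain ⟨x, hx⟩ := hev.exists_hasEigenvector
    have hx1 : R x = -l⁻¹ • x := hx.apply_eq_smul
    obtain ⟨h1, h2⟩ := hAR x
    have h3 : A ⟨R x, h1⟩ = 0 := by
      have : l • R x = -x := by rw [hx1, smul_smul]; simp [hl]
      rw [this] at h2
      simpa using h2
    have h4 : (⟨R x, h1⟩ : A.domain) = 0 := hcoer.injective (by rw [h3, A.map_zero])
    have h5 : R x = 0 := congrArg Subtype.val h4
    rw [h5] at hx1
    exact hx.2 ((smul_eq_zero.1 hx1.symm).resolve_left hμ)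
  · rw [spectrum.mem_resolventSet_iff] at hres
    obtain ⟨G, hG⟩ := hres.exists_right_inv
    refine ⟨R ∘L (-l⁻¹ • G), hR.comp_clm _, fun f => ?_⟩
    obtain ⟨h1, h2⟩ := hAR ((-l⁻¹ • G) f)
    refine ⟨h1, ?_⟩
    have h3 : -l⁻¹ • G f - R (G f) = f := by
      have := DFunLike.congr_fun hG f
      simpa [Algebra.algebraMap_eq_smul_one] using this
    rw [sub_eq_iff_eq_add] at h2
    refine h2.trans ?_
    have h4 : R (G f) = -l⁻¹ • G f - f := by
      rw [eq_sub_iff_add_eq, add_comm]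
      exact (sub_eq_iff_eq_add.1 h3).symm
    have h5 : (-l⁻¹ • G) f = -l⁻¹ • G f := rfl
    rw [h5, map_smul, h4, smul_smul, mul_neg, mul_inv_cancel₀ hl]
    module

/-- The spectral theorem for `A`, from the one for its compact inverse. -/
theorem exists_eigenbasis (hA : IsSelfAdjoint A) (hcoer : IsCoercive A)
    (hcomp : HasCompactResolvent A) (hsimple : HasSimpleSpectrum A) :
    ∃ b : HilbertBasis (EigenIndex A) ℂ H, ∀ i, b i ∈ eigenspace A (i.1 : ℂ) := by
  have hex : ∀ i : EigenIndex A, ∃ e : H, e ∈ eigenspace A (i.1 : ℂ) ∧ ‖e‖ = 1 := by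
    intro i
    obtain ⟨x, hx, hx0⟩ := Submodule.exists_mem_ne_zero_of_ne_bot i.2
    refine ⟨((‖x‖⁻¹ : ℝ) : ℂ) • x, Submodule.smul_mem _ _ hx, ?_⟩
    have := norm_ne_zero_iff.2 hx0
    rw [norm_smul, Complex.norm_real, norm_inv, norm_norm, inv_mul_cancel₀ this]
  choose e he he1 using hex
  have hortho : Orthonormal ℂ e := by
    refine ⟨he1, fun i j hij => ?_⟩
    obtain ⟨hi, hi'⟩ := he i
    obtain ⟨hj, hj'⟩ := he j
    have h := inner_map_symm hA ⟨e i, hi⟩ ⟨e j, hj⟩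
    rw [hi', hj', inner_smul_left, inner_smul_right, Complex.conj_ofReal] at h
    have h' : ((i.1 : ℂ) - j.1) * inner ℂ (e i) (e j) = 0 := by
      rw [sub_mul]
      exact sub_eq_zero.2 h
    refine (mul_eq_zero.1 h').resolve_left fun h0 => hij (Subtype.ext ?_)
    exact_mod_cast sub_eq_zero.1 h0
  obtain ⟨T, hT, hAT⟩ := exists_compact_inverse hcoer hcomp
  have hTsymm : (T : H →ₗ[ℂ] H).IsSymmetric := by
    intro f g
    obtain ⟨hf, hf'⟩ := hAT f
    obtain ⟨hg, hg'⟩ := hAT g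
    have h := inner_map_symm hA ⟨T f, hf⟩ ⟨T g, hg⟩
    rw [hf', hg'] at h
    exact h.symm
  have hle : (⨆ μ, Module.End.eigenspace (T : Module.End ℂ H) μ) ≤
      Submodule.span ℂ (Set.range e) := by
    refine iSup_le fun μ y hy => ?_
    by_cases hy0 : y = 0
    · rw [hy0]
      exact zero_mem _
    have hTy : T y = μ • y := Module.End.mem_eigenspace_iff.1 hy
    obtain ⟨h1, h2⟩ := hAT y
    have hμ0 : μ ≠ 0 := by
      rintro rfl
      have h3 : (⟨T y, h1⟩ : A.domain) = 0 := Subtype.ext (hTy.trans (zero_smul ℂ y))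
      rw [h3, A.map_zero] at h2
      exact hy0 h2.symm
    have hμr : (starRingEnd ℂ) μ = μ :=
      hTsymm.conj_eigenvalue_eq_self (Module.End.hasEigenvalue_of_hasEigenvector ⟨hy, hy0⟩)
    obtain ⟨r, rfl⟩ := Complex.conj_eq_iff_real.1 hμr
    have hyd : y ∈ A.domain := by
      have : y = (r : ℂ)⁻¹ • T y := by rw [hTy, smul_smul, inv_mul_cancel₀ hμ0, one_smul]
      rw [this]
      exact A.domain.smul_mem _ h1
    have hyA : y ∈ eigenspace A ((r⁻¹ : ℝ) : ℂ) := by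
      refine ⟨hyd, ?_⟩
      have h3 : (⟨T y, h1⟩ : A.domain) = (r : ℂ) • ⟨y, hyd⟩ := Subtype.ext hTy
      rw [h3, A.map_smul] at h2
      rw [Complex.ofReal_inv, eq_inv_smul_iff₀ hμ0]
      exact h2
    let i : EigenIndex A := ⟨r⁻¹, fun h => hy0 (by
      rw [h] at hyA
      exact (Submodule.mem_bot ℂ).1 hyA)⟩
    have hei0 : e i ≠ 0 := norm_ne_zero_iff.1 (by rw [he1]; exact one_ne_zero)
    exact Submodule.span_mono (Set.singleton_subset_iff.2 (Set.mem_range_self i))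
      (eigenspace_le_span hsimple (he i) hei0 hyA)
  have hbot : (Submodule.span ℂ (Set.range e))ᗮ = ⊥ := by
    rw [eq_bot_iff, ← ContinuousLinearMap.orthogonalComplement_iSup_eigenspaces_eq_bot hT hTsymm]
    exact Submodule.orthogonal_le hle
  refine ⟨HilbertBasis.mkOfOrthogonalEqBot hortho hbot, fun i => ?_⟩
  rw [HilbertBasis.coe_mkOfOrthogonalEqBot]
  exact he i

variable {b : HilbertBasis (EigenIndex A) ℂ H}

/-- The graph of `A` in the eigenbasis. -/
theorem graph_iff_repr (hA : IsSelfAdjoint A) (hcoer : IsCoercive A) (hcomp : HasCompactResolvent A)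
    (hb : ∀ i, b i ∈ eigenspace A (i.1 : ℂ)) (u w : H) :
    (∃ h : u ∈ A.domain, A ⟨u, h⟩ = w) ↔ ∀ i, b.repr w i = (i.1 : ℂ) * b.repr u i := by
  have hto : ∀ (u : H) (h : u ∈ A.domain) i,
      b.repr (A ⟨u, h⟩) i = (i.1 : ℂ) * b.repr u i := by
    intro u h i
    obtain ⟨hi, hi'⟩ := hb i
    have h := inner_map_symm hA ⟨b i, hi⟩ ⟨u, h⟩
    rw [hi', inner_smul_left, Complex.conj_ofReal] at h
    rw [b.repr_apply_apply, b.repr_apply_apply, h]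
  constructor
  · rintro ⟨h, rfl⟩
    exact hto u h
  · intro h
    obtain ⟨T, -, hAT⟩ := exists_compact_inverse hcoer hcomp
    obtain ⟨h1, h2⟩ := hAT w
    obtain ⟨c, hc, hci⟩ := exists_le_eigenIndex hcoer
    have h3 : T w = u := by
      refine ext_repr b fun i => ?_
      have h4 := hto _ h1 i
      rw [h2, h i] at h4
      have : (i.1 : ℂ) ≠ 0 := Complex.ofReal_ne_zero.2 (hc.trans_le (hci i)).ne'
      exact (mul_left_cancel₀ this h4).symm
    subst h3
    exact ⟨h1, h2⟩

theorem spectralProj_eigenIndex (hsimple : HasSimpleSpectrum A)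
    (hb : ∀ i, b i ∈ eigenspace A (i.1 : ℂ)) (i : EigenIndex A) (u : H) :
    spectralProj A i.1 u = b.repr u i • b i := by
  have hb1 : ‖b i‖ = 1 := b.orthonormal.1 i
  have hb0 : b i ≠ 0 := norm_ne_zero_iff.1 (by rw [hb1]; exact one_ne_zero)
  refine Submodule.eq_starProjection_of_mem_of_inner_eq_zero
    (Submodule.smul_mem _ _ (Submodule.le_topologicalClosure _ (hb i))) fun w hw => ?_
  have hle : (eigenspace A (i.1 : ℂ)).topologicalClosure ≤ Submodule.span ℂ {b i} :=
    Submodule.topologicalClosure_minimal _ (fun y hy => eigenspace_le_span hsimple (hb i) hb0 hy)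
      (Submodule.closed_of_finiteDimensional _)
  obtain ⟨r, rfl⟩ := Submodule.mem_span_singleton.1 (hle hw)
  rw [inner_smul_right, inner_sub_left, inner_smul_left, inner_self_eq_norm_sq_to_K, hb1,
    b.repr_apply_apply, inner_conj_symm]
  simp

theorem spectralProj_eq_zero {l : ℝ} (hl : eigenspace A (l : ℂ) = ⊥) (u : H) :
    spectralProj A l u = 0 := by
  have h : spectralProj A l u ∈ (eigenspace A (l : ℂ)).topologicalClosure :=
    Submodule.starProjection_apply_mem _ _
  have h2 : (eigenspace A (l : ℂ)).topologicalClosure ≤ ⊥ :=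
    Submodule.topologicalClosure_minimal _ hl.le (Submodule.closed_of_finiteDimensional _)
  exact (Submodule.mem_bot ℂ).1 (h2 h)

/-- The graph of `A ^ s` in the eigenbasis. -/
theorem fracPow_graph_iff_repr (hsimple : HasSimpleSpectrum A)
    (hb : ∀ i, b i ∈ eigenspace A (i.1 : ℂ)) (s : ℝ) (u w : H) :
    (∃ h : u ∈ (fracPow A s).domain, fracPow A s ⟨u, h⟩ = w) ↔
      ∀ i, b.repr w i = ((i.1 ^ s : ℝ) : ℂ) * b.repr u i := by
  classical
  have hsum : (∃ h : u ∈ (fracPow A s).domain, fracPow A s ⟨u, h⟩ = w) ↔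
      HasSum (fun l : ℝ => ((l ^ s : ℝ) : ℂ) • spectralProj A l u) w := by
    constructor
    · rintro ⟨h, rfl⟩
      exact Summable.hasSum h
    · intro h
      exact ⟨h.summable, h.tsum_eq⟩
  have hsub : HasSum (fun l : ℝ => ((l ^ s : ℝ) : ℂ) • spectralProj A l u) w ↔
      HasSum (fun i : EigenIndex A => (((i.1 ^ s : ℝ) : ℂ) * b.repr u i) • b i) w := by
    rw [← (Subtype.val_injective : Function.Injective
      (Subtype.val : EigenIndex A → ℝ)).hasSum_iff]
    · refine iff_of_eq (congrArg (fun f => HasSum f w _) (funext fun i => ?_))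
      rw [Function.comp_apply, spectralProj_eigenIndex hsimple hb, smul_smul]
    · intro l hl
      have hbot : eigenspace A (l : ℂ) = ⊥ := by
        by_contra h
        exact hl ⟨⟨l, h⟩, rfl⟩
      rw [spectralProj_eq_zero hbot, smul_zero]
  rw [hsum, hsub]
  constructor
  · intro h i
    have h1 := h.mapL (innerSL ℂ (b i))
    have h2 : HasSum (fun j : EigenIndex A =>
        innerSL ℂ (b i) ((((j.1 ^ s : ℝ) : ℂ) * b.repr u j) • b j))
        (innerSL ℂ (b i) ((((i.1 ^ s : ℝ) : ℂ) * b.repr u i) • b i)) := by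
      refine hasSum_single i fun j hj => ?_
      rw [innerSL_apply_apply, inner_smul_right, b.orthonormal.2 hj.symm, mul_zero]
    have h3 := h1.unique h2
    rw [innerSL_apply_apply, innerSL_apply_apply, inner_smul_right, inner_self_eq_norm_sq_to_K,
      b.orthonormal.1 i] at h3
    rw [b.repr_apply_apply, h3]
    simp
  · intro h
    have h1 := b.hasSum_repr w
    simpa only [h] using h1

theorem repr_fracPow (hsimple : HasSimpleSpectrum A) (hb : ∀ i, b i ∈ eigenspace A (i.1 : ℂ))
    (s : ℝ) (u : (fracPow A s).domain) (i : EigenIndex A) :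
    b.repr (fracPow A s u) i = ((i.1 ^ s : ℝ) : ℂ) * b.repr (u : H) i :=
  (fracPow_graph_iff_repr hsimple hb s u (fracPow A s u)).1 ⟨u.2, rfl⟩ i

/-- In infinite dimension the eigenvalues are unbounded: otherwise `A` would be bounded, and the
identity `A A⁻¹` compact. -/
theorem exists_eigenIndex_gt (hH : ¬ FiniteDimensional ℂ H) (hA : IsSelfAdjoint A)
    (hcoer : IsCoercive A) (hcomp : HasCompactResolvent A)
    (hb : ∀ i, b i ∈ eigenspace A (i.1 : ℂ)) (L : ℝ) : ∃ i : EigenIndex A, L < i.1 := by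
  by_contra hcon
  push Not at hcon
  obtain ⟨c, hc, hci⟩ := exists_le_eigenIndex hcoer
  have hbound : ∀ (u : H) i, ‖(i.1 : ℂ) * b.repr u i‖ ^ 2 ≤ L ^ 2 * ‖b.repr u i‖ ^ 2 := by
    intro u i
    have h0 := hc.le.trans (hci i)
    have h1 := hcon i
    rw [norm_ofReal_mul_sq]
    gcongr
  have hsum : ∀ u : H, Summable fun i : EigenIndex A => ‖(i.1 : ℂ) * b.repr u i‖ ^ 2 := fun u =>
    ((summable_norm_sq (b.repr u)).mul_left (L ^ 2)).of_nonneg_of_le (fun _ => by positivity)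
      (hbound u)
  have hdom : ∀ u : H, u ∈ A.domain := by
    intro u
    obtain ⟨w, hw⟩ := exists_repr_eq b (hsum u)
    exact ((graph_iff_repr hA hcoer hcomp hb u w).2 hw).1
  let B : H →ₗ[ℂ] H :=
    { toFun := fun u => A ⟨u, hdom u⟩
      map_add' := fun u v => A.map_add ⟨u, hdom u⟩ ⟨v, hdom v⟩
      map_smul' := fun r u => A.map_smul r ⟨u, hdom u⟩ }
  have hB : ∀ u, ‖B u‖ ≤ |L| * ‖u‖ := by
    intro u
    refine le_of_sq_le_sq ?_ (by positivity)
    have hw := (graph_iff_repr hA hcoer hcomp hb u (B u)).1 ⟨hdom u, rfl⟩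
    rw [mul_pow, sq_abs, norm_sq_eq_tsum_repr b, norm_sq_eq_tsum_repr b u, ← tsum_mul_left]
    simp only [hw]
    exact (hsum u).tsum_le_tsum (hbound u) ((summable_norm_sq (b.repr u)).mul_left _)
  obtain ⟨T, hT, hAT⟩ := exists_compact_inverse hcoer hcomp
  have hid : ⇑(B.mkContinuous |L| hB) ∘ ⇑T = id := funext fun f => (hAT f).2
  have hcid := hT.clm_comp (B.mkContinuous |L| hB)
  rw [hid] at hcid
  exact hH ((isCompactOperator_id_iff_finiteDimensional (𝕜 := ℂ)).1 hcid)

end Spectral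

/-! ### The energy space as a direct sum of modes -/

section Coordinates

variable {H : Type*} [NormedAddCommGroup H] [InnerProductSpace ℂ H] [CompleteSpace H]
  {A : H →ₗ.[ℂ] H}

/-- The coordinates of an element of the energy space in the mode `i`. -/
noncomputable def modeCoord (b : HilbertBasis (EigenIndex A) ℂ H) (a : ℝ) (U : EnergySpace A)
    (i : EigenIndex A) : ModeSpace :=
  !₂[(√a : ℂ) * b.repr (fracPow A (1 / 2) U.1) i, b.repr U.2.1 i,
    b.repr (fracPow A (1 / 2) U.2.2.1) i, b.repr U.2.2.2 i]

variable (b : HilbertBasis (EigenIndex A) ℂ H) {a γ α : ℝ}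

theorem hasSum_norm_modeCoord_sq (ha : 0 < a) (U : EnergySpace A) :
    HasSum (fun i => ‖modeCoord b a U i‖ ^ 2) (energyNormSq A a U) := by
  have h : ∀ u : H, HasSum (fun i => ‖b.repr u i‖ ^ 2) (‖u‖ ^ 2) := fun u => by
    rw [norm_sq_eq_tsum_repr b]
    exact (summable_norm_sq _).hasSum
  have h1 := ((((h (fracPow A (1 / 2) U.1)).mul_left a).add (h (fracPow A (1 / 2) U.2.2.1))).add
    (h U.2.1)).add (h U.2.2.2)
  refine h1.congr_fun fun i => ?_
  rw [modeSpace_norm_sq]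
  simp [modeCoord, mul_pow, Real.sq_sqrt ha.le]
  ring

/-- The energy space is the Hilbert sum of the modes. -/
noncomputable def modeMap (ha : 0 < a) :
    EnergySpace A →ₗ[ℂ] lp (fun _ : EigenIndex A => ModeSpace) 2 where
  toFun U := ⟨modeCoord b a U, memℓp_two_iff.2 (hasSum_norm_modeCoord_sq b ha U).summable⟩
  map_add' U V := lp.ext <| funext fun i => by
    change modeCoord b a (U + V) i = modeCoord b a U i + modeCoord b a V i
    ext j
    fin_cases j <;> (simp [modeCoord, (fracPow A (1 / 2)).map_add]; try ring)
  map_smul' c U := lp.ext <| funext fun i => by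
    change modeCoord b a (c • U) i = c • modeCoord b a U i
    ext j
    fin_cases j <;> (simp [modeCoord, (fracPow A (1 / 2)).map_smul]; try ring)

theorem modeMap_apply (ha : 0 < a) (U : EnergySpace A) (i : EigenIndex A) :
    modeMap b ha U i = modeCoord b a U i := rfl

theorem norm_modeMap_sq (ha : 0 < a) (U : EnergySpace A) :
    ‖modeMap b ha U‖ ^ 2 = energyNormSq A a U := by
  rw [norm_sq_eq_tsum]
  exact (hasSum_norm_modeCoord_sq b ha U).tsum_eq

theorem norm_modeMap (ha : 0 < a) (U : EnergySpace A) :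
    ‖modeMap b ha U‖ = energyNorm A a U := by
  rw [energyNorm, ← norm_modeMap_sq b ha U, Real.sqrt_sq (norm_nonneg _)]

variable {b} (hsimple : HasSimpleSpectrum A) (hb : ∀ i, b i ∈ eigenspace A (i.1 : ℂ))
include hsimple hb

theorem modeCoord_eq (U : EnergySpace A) (i : EigenIndex A) :
    modeCoord b a U i = !₂[(√a * √i.1 : ℂ) * b.repr (U.1 : H) i, b.repr U.2.1 i,
      (√i.1 : ℂ) * b.repr (U.2.2.1 : H) i, b.repr U.2.2.2 i] := by
  unfold modeCoord
  rw [repr_fracPow hsimple hb, repr_fracPow hsimple hb, Real.sqrt_eq_rpow i.1, mul_assoc]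

theorem modeMap_injective (ha : 0 < a) (hcoer : IsCoercive A) :
    Function.Injective (modeMap b ha) := by
  intro U V h
  obtain ⟨c, hc, hci⟩ := exists_le_eigenIndex hcoer
  have hc' : ∀ i, modeCoord b a U i = modeCoord b a V i := fun i => by
    rw [← modeMap_apply b ha, h, modeMap_apply]
  have key : ∀ (i : EigenIndex A) (j : Fin 4), modeCoord b a U i j = modeCoord b a V i j :=
    fun i j => by rw [hc']
  simp only [modeCoord_eq hsimple hb] at key
  have hsi : ∀ i : EigenIndex A, (√i.1 : ℂ) ≠ 0 := fun i =>
    Complex.ofReal_ne_zero.2 (Real.sqrt_pos.2 (hc.trans_le (hci i))).ne'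
  have hsa : (√a : ℂ) ≠ 0 := Complex.ofReal_ne_zero.2 (Real.sqrt_pos.2 ha).ne'
  refine Prod.ext (Subtype.ext (ext_repr b fun i => ?_)) (Prod.ext (ext_repr b fun i => ?_)
    (Prod.ext (Subtype.ext (ext_repr b fun i => ?_)) (ext_repr b fun i => ?_)))
  · exact mul_left_cancel₀ (mul_ne_zero hsa (hsi i)) (key i 0)
  · exact key i 1
  · exact mul_left_cancel₀ (hsi i) (key i 2)
  · exact key i 3

/-- `A ^ (1/2)` is onto. -/
theorem exists_fracPow_half_eq (hcoer : IsCoercive A) (w : H) :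
    ∃ u : (fracPow A (1 / 2)).domain, fracPow A (1 / 2) u = w := by
  obtain ⟨c, hc, hci⟩ := exists_le_eigenIndex hcoer
  have hs : Summable fun i : EigenIndex A => ‖(((√i.1)⁻¹ : ℝ) : ℂ) * b.repr w i‖ ^ 2 := by
    refine ((summable_norm_sq (b.repr w)).mul_left c⁻¹).of_nonneg_of_le (fun _ => by positivity)
      fun i => ?_
    have h0 : 0 < i.1 := hc.trans_le (hci i)
    rw [norm_ofReal_mul_sq, inv_pow, Real.sq_sqrt h0.le]
    have := hci i
    gcongr
  obtain ⟨u, hu⟩ := exists_repr_eq b hs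
  obtain ⟨h1, h2⟩ := (fracPow_graph_iff_repr hsimple hb (1 / 2) u w).2 fun i => by
    have h0 : 0 < √i.1 := Real.sqrt_pos.2 (hc.trans_le (hci i))
    rw [hu, ← Real.sqrt_eq_rpow, ← mul_assoc, ← Complex.ofReal_mul, mul_inv_cancel₀ h0.ne',
      Complex.ofReal_one, one_mul]
  exact ⟨⟨u, h1⟩, h2⟩

theorem modeMap_surjective (ha : 0 < a) (hcoer : IsCoercive A) :
    Function.Surjective (modeMap b ha) := by
  intro X
  have hs : ∀ j, Summable fun i => ‖X i j‖ ^ 2 := fun j =>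
    (summable_norm_sq X).of_nonneg_of_le (fun _ => by positivity)
      fun i => norm_apply_sq_le (X i) j
  obtain ⟨w, hw⟩ := exists_repr_eq b (hs 0)
  obtain ⟨v, hv⟩ := exists_repr_eq b (hs 1)
  obtain ⟨q, hq⟩ := exists_repr_eq b (hs 2)
  obtain ⟨z, hz⟩ := exists_repr_eq b (hs 3)
  obtain ⟨u, hu⟩ := exists_fracPow_half_eq hsimple hb hcoer ((√a : ℂ)⁻¹ • w)
  obtain ⟨y, hy⟩ := exists_fracPow_half_eq hsimple hb hcoer q
  have hsa : (√a : ℂ) ≠ 0 := Complex.ofReal_ne_zero.2 (Real.sqrt_pos.2 ha).ne'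
  refine ⟨(u, v, y, z), lp.ext <| funext fun i => ?_⟩
  rw [modeMap_apply]
  ext j
  fin_cases j
  · simp [modeCoord, hu, hw, hsa]
  · simp [modeCoord, hv]
  · simp [modeCoord, hy, hq]
  · simp [modeCoord, hz]

/-- The isometry between the energy space and the Hilbert sum of the modes. -/
noncomputable def modeEquiv (ha : 0 < a) (hcoer : IsCoercive A) :
    EnergySpace A ≃ₗ[ℂ] lp (fun _ : EigenIndex A => ModeSpace) 2 :=
  LinearEquiv.ofBijective (modeMap b ha)
    ⟨modeMap_injective hsimple hb ha hcoer, modeMap_surjective hsimple hb ha hcoer⟩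

theorem modeEquiv_apply (ha : 0 < a) (hcoer : IsCoercive A) (U : EnergySpace A) :
    modeEquiv hsimple hb ha hcoer U = modeMap b ha U := rfl

theorem modeMap_systemOp (hA : IsSelfAdjoint A) (hcoer : IsCoercive A)
    (hcomp : HasCompactResolvent A) (ha : 0 < a) (U : (systemOp A a γ α).domain)
    (i : EigenIndex A) :
    modeMap b ha (systemOp A a γ α U) i = systemMode a γ α i.1 (modeMap b ha U i) := by
  obtain ⟨c, hc, hci⟩ := exists_le_eigenIndex hcoer
  have hi : 0 < i.1 := hc.trans_le (hci i)
  have hAu := (graph_iff_repr hA hcoer hcomp hb (U.1.1 : H) _).1 ⟨U.2.1, rfl⟩ i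
  have hAy := (graph_iff_repr hA hcoer hcomp hb (U.1.2.2.1 : H) _).1 ⟨U.2.2.2.1, rfl⟩ i
  have hAv := (fracPow_graph_iff_repr hsimple hb γ (U.1.2.1 : H) _).1 ⟨U.2.2.2.2.2, rfl⟩ i
  have hls : (√i.1 : ℂ) * √i.1 = i.1 := by rw [← Complex.ofReal_mul, Real.mul_self_sqrt hi.le]
  have has : (√a : ℂ) * √a = a := by rw [← Complex.ofReal_mul, Real.mul_self_sqrt ha.le]
  rw [modeMap_apply, modeMap_apply, modeCoord_eq hsimple hb, modeCoord_eq hsimple hb]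
  change !₂[(√a * √i.1 : ℂ) * b.repr U.1.2.1 i,
    b.repr (-((a : ℂ) • A ⟨U.1.1, U.2.1⟩) - fracPow A γ ⟨U.1.2.1, U.2.2.2.2.2⟩ -
      (α : ℂ) • U.1.2.2.2) i,
    (√i.1 : ℂ) * b.repr U.1.2.2.2 i,
    b.repr (-(A ⟨U.1.2.2.1, U.2.2.2.1⟩) + (α : ℂ) • U.1.2.1) i] = _
  simp only [map_sub, map_add, map_neg, map_smul, lp.coeFn_sub, lp.coeFn_add, lp.coeFn_neg,
    lp.coeFn_smul, Pi.sub_apply, Pi.add_apply, Pi.neg_apply, Pi.smul_apply, smul_eq_mul]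
  ext j
  fin_cases j
  · simp [modeOp_apply_zero]
  · simp only [Fin.mk_one, modeOp_apply_one]
    simp
    rw [hAu, hAv]
    linear_combination (a * b.repr (U.1.1 : H) i : ℂ) * hls +
      (b.repr (U.1.1 : H) i * √i.1 * √i.1 : ℂ) * has
  · simp [modeOp_apply_two]
  · simp [modeOp_apply_three]
    rw [hAy]
    linear_combination -(b.repr (U.1.2.2.1 : H) i) * hls

/-- In the coordinates of the modes, the evolution operator is the diagonal operator with entries
`systemMode a γ α i`, on its maximal domain. -/
theorem systemOp_graph_iff (hA : IsSelfAdjoint A) (hcoer : IsCoercive A)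
    (hcomp : HasCompactResolvent A) (ha : 0 < a) (hγ : γ ≤ 0) (U W : EnergySpace A) :
    (∃ h : U ∈ (systemOp A a γ α).domain, systemOp A a γ α ⟨U, h⟩ = W) ↔
      ∀ i, modeMap b ha W i = systemMode a γ α i.1 (modeMap b ha U i) := by
  constructor
  · rintro ⟨h, rfl⟩ i
    exact modeMap_systemOp hsimple hb hA hcoer hcomp ha ⟨U, h⟩ i
  · intro h
    obtain ⟨c, hc, hci⟩ := exists_le_eigenIndex hcoer
    have hsi : ∀ i : EigenIndex A, (√i.1 : ℂ) ≠ 0 := fun i =>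
      Complex.ofReal_ne_zero.2 (Real.sqrt_pos.2 (hc.trans_le (hci i))).ne'
    have hsa : (√a : ℂ) ≠ 0 := Complex.ofReal_ne_zero.2 (Real.sqrt_pos.2 ha).ne'
    have hls : ∀ i : EigenIndex A, (√i.1 : ℂ) * √i.1 = i.1 := fun i => by
      rw [← Complex.ofReal_mul, Real.mul_self_sqrt (hc.le.trans (hci i))]
    have has : (√a : ℂ) * √a = a := by rw [← Complex.ofReal_mul, Real.mul_self_sqrt ha.le]
    have ha0 : (a : ℂ) ≠ 0 := Complex.ofReal_ne_zero.2 ha.ne'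
    have key : ∀ (i : EigenIndex A) (j : Fin 4), modeCoord b a W i j =
        systemMode a γ α i.1 (modeCoord b a U i) j := fun i j => by
      rw [← modeMap_apply b ha, h, modeMap_apply]
    simp only [modeCoord_eq hsimple hb] at key
    have k0 : ∀ i, (√a * √i.1 : ℂ) * b.repr (W.1 : H) i = (√a * √i.1 : ℂ) * b.repr U.2.1 i :=
      fun i => (key i 0).trans (modeOp_apply_zero _ _ _ _ _)
    have k1 : ∀ i, b.repr W.2.1 i = -(√a * √i.1 : ℂ) * ((√a * √i.1 : ℂ) * b.repr (U.1 : H) i) -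
        ((i.1 ^ γ : ℝ) : ℂ) * b.repr U.2.1 i - α * b.repr U.2.2.2 i :=
      fun i => (key i 1).trans (modeOp_apply_one _ _ _ _ _)
    have k2 : ∀ i, (√i.1 : ℂ) * b.repr (W.2.2.1 : H) i = √i.1 * b.repr U.2.2.2 i :=
      fun i => (key i 2).trans (modeOp_apply_two _ _ _ _ _)
    have k3 : ∀ i, b.repr W.2.2.2 i = -(√i.1 : ℂ) * ((√i.1 : ℂ) * b.repr (U.2.2.1 : H) i) +
        α * b.repr U.2.1 i :=
      fun i => (key i 3).trans (modeOp_apply_three _ _ _ _ _)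
    have hv : (W.1 : H) = U.2.1 :=
      ext_repr b fun i => mul_left_cancel₀ (mul_ne_zero hsa (hsi i)) (k0 i)
    have hz : (W.2.2.1 : H) = U.2.2.2 := ext_repr b fun i => mul_left_cancel₀ (hsi i) (k2 i)
    have hvγ : U.2.1 ∈ (fracPow A γ).domain := by
      rw [fracPow_domain_eq_top hA hcoer hγ]
      trivial
    have hAv := (fracPow_graph_iff_repr hsimple hb γ U.2.1 _).1 ⟨hvγ, rfl⟩
    have hu : (U.1 : H) ∈ A.domain := by
      refine ((graph_iff_repr hA hcoer hcomp hb (U.1 : H)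
        (-(a : ℂ)⁻¹ • (W.2.1 + fracPow A γ ⟨U.2.1, hvγ⟩ + (α : ℂ) • U.2.2.2))).2 fun i => ?_).1
      simp only [map_add, map_smul, lp.coeFn_add, lp.coeFn_smul, Pi.add_apply, Pi.smul_apply,
        smul_eq_mul]
      rw [hAv, k1]
      field_simp
      linear_combination (a * b.repr (U.1 : H) i : ℂ) * hls i +
        (b.repr (U.1 : H) i * √i.1 * √i.1 : ℂ) * has
    have hy : (U.2.2.1 : H) ∈ A.domain := by
      refine ((graph_iff_repr hA hcoer hcomp hb (U.2.2.1 : H)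
        (-W.2.2.2 + (α : ℂ) • U.2.1)).2 fun i => ?_).1
      simp only [map_add, map_neg, map_smul, lp.coeFn_add, lp.coeFn_neg, lp.coeFn_smul,
        Pi.add_apply, Pi.neg_apply, Pi.smul_apply, smul_eq_mul]
      rw [k3]
      linear_combination (b.repr (U.2.2.1 : H) i) * hls i
    have hdom : U ∈ (systemOp A a γ α).domain :=
      ⟨hu, hv ▸ W.1.2, hy, hz ▸ W.2.2.1.2, hvγ⟩
    refine ⟨hdom, modeMap_injective hsimple hb ha hcoer (lp.ext (funext fun i => ?_))⟩
    rw [h i]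
    exact modeMap_systemOp hsimple hb hA hcoer hcomp ha ⟨U, hdom⟩ i

end Coordinates

/-! ### Transfer to the energy space -/

section Transfer

variable {E F : Type*} [AddCommGroup E] [Module ℂ E] [AddCommGroup F] [Module ℂ F]

theorem IsContractionSemigroup.conj {nE : E → ℝ} {nF : F → ℝ} {S : ℝ → E →ₗ[ℂ] E}
    (hS : IsContractionSemigroup nE S) (e : E ≃ₗ[ℂ] F) (he : ∀ x, nF (e x) = nE x) :
    IsContractionSemigroup nF fun t => e.toLinearMap ∘ₗ S t ∘ₗ e.symm.toLinearMap where
  map_zero := by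
    ext x
    simp [hS.map_zero]
  map_add s t hs ht := by
    ext x
    simp [hS.map_add s t hs ht]
  contraction t ht x := by
    have h := hS.contraction t ht (e.symm x)
    rw [← he, ← he (e.symm x), e.apply_symm_apply] at h
    exact h
  continuous x := by
    refine (hS.continuous (e.symm x)).congr fun t => ?_
    rw [← he, map_sub, e.apply_symm_apply]
    rfl

theorem conj_slope_eq {nE : E → ℝ} {nF : F → ℝ} (S : ℝ → E →ₗ[ℂ] E) (e : E ≃ₗ[ℂ] F)
    (he : ∀ x, nF (e x) = nE x) (c : ℂ) (t : ℝ) (x w : F) :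
    nF (c • ((e.toLinearMap ∘ₗ S t ∘ₗ e.symm.toLinearMap) x - x) - w) =
      nE (c • (S t (e.symm x) - e.symm x) - e.symm w) := by
  rw [← he]
  simp

end Transfer

/-! ### The semigroup of the coupled system -/

section System

variable {H : Type*} [NormedAddCommGroup H] [InnerProductSpace ℂ H] {A : H →ₗ.[ℂ] H}

theorem isDissipative_systemMode (hcoer : IsCoercive A) (a γ α : ℝ) (i : EigenIndex A) :
    IsDissipative (systemMode a γ α i.1) := by
  obtain ⟨c, hc, hci⟩ := exists_le_eigenIndex hcoer
  exact isDissipative_modeOp _ _ _ (Real.rpow_nonneg (hc.le.trans (hci i)) γ)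

variable [CompleteSpace H] {b : HilbertBasis (EigenIndex A) ℂ H} {a γ α : ℝ}

theorem exists_isSystemSemigroup (hsimple : HasSimpleSpectrum A)
    (hb : ∀ i, b i ∈ eigenspace A (i.1 : ℂ)) (hA : IsSelfAdjoint A) (hcoer : IsCoercive A)
    (hcomp : HasCompactResolvent A) (ha : 0 < a) (hγ : γ ≤ 0) (α : ℝ) :
    ∃ S : ℝ → EnergySpace A →ₗ[ℂ] EnergySpace A, IsSystemSemigroup A a γ α S := by
  have hM := isDissipative_systemMode hcoer a γ α
  let e := modeEquiv hsimple hb ha hcoer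
  have he : ∀ X, energyNorm A a (e.symm X) = ‖X‖ := fun X => by
    rw [← norm_modeMap b ha, ← modeEquiv_apply hsimple hb ha hcoer, e.apply_symm_apply]
  refine ⟨fun t => e.symm.toLinearMap ∘ₗ modeFlow hM t ∘ₗ e.symm.symm.toLinearMap,
    (isContractionSemigroup_modeFlow hM).conj e.symm he, fun U W => ?_⟩
  rw [systemOp_graph_iff hsimple hb hA hcoer hcomp ha hγ, modeFlow_generator hM]
  refine iff_of_eq (congrArg (fun f => Tendsto f _ _) (funext fun t => ?_))
  rw [conj_slope_eq (nE := fun X => ‖X‖) (nF := energyNorm A a) (modeFlow hM) e.symm he]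
  rfl

/-- Every semigroup generated by the evolution operator acts on the modes of an element of the
domain by the exponentials of the mode operators. -/
theorem modeMap_semigroup (hsimple : HasSimpleSpectrum A)
    (hb : ∀ i, b i ∈ eigenspace A (i.1 : ℂ)) (hA : IsSelfAdjoint A) (hcoer : IsCoercive A)
    (hcomp : HasCompactResolvent A) (ha : 0 < a) (hγ : γ ≤ 0)
    {S : ℝ → EnergySpace A →ₗ[ℂ] EnergySpace A} (hS : IsSystemSemigroup A a γ α S)
    (U : (systemOp A a γ α).domain) {t : ℝ} (ht : 0 ≤ t) (i : EigenIndex A) :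
    modeMap b ha (S t U) i = flow (systemMode a γ α i.1) t (modeMap b ha U i) := by
  let e := modeEquiv hsimple hb ha hcoer
  have he : ∀ U, ‖e U‖ = energyNorm A a U := norm_modeMap b ha
  have h := semigroup_apply_eq_flow (M := fun i : EigenIndex A => systemMode a γ α i.1)
    (hS.1.conj e he) (fun X W => ?_) (modeMap_systemOp hsimple hb hA hcoer hcomp ha U) ht i
  · have h2 : e.symm (modeMap b ha U) = U := e.symm_apply_apply U
    simp only [LinearMap.comp_apply, LinearEquiv.coe_coe, h2] at h
    exact h
  · have h1 := systemOp_graph_iff (α := α) hsimple hb hA hcoer hcomp ha hγ (e.symm X) (e.symm W)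
    have h2 : ∀ X, modeMap b ha (e.symm X) = X := e.apply_symm_apply
    rw [h2, h2] at h1
    rw [← h1, hS.2 (e.symm X) (e.symm W)]
    refine iff_of_eq (congrArg (fun f => Tendsto f _ _) (funext fun t => ?_))
    rw [conj_slope_eq S e he]

theorem energy_eq_tsum (hsimple : HasSimpleSpectrum A)
    (hb : ∀ i, b i ∈ eigenspace A (i.1 : ℂ)) (hA : IsSelfAdjoint A) (hcoer : IsCoercive A)
    (hcomp : HasCompactResolvent A) (ha : 0 < a) (hγ : γ ≤ 0)
    {S : ℝ → EnergySpace A →ₗ[ℂ] EnergySpace A} (hS : IsSystemSemigroup A a γ α S)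
    (U : (systemOp A a γ α).domain) {t : ℝ} (ht : 0 ≤ t) :
    energy A a S U t =
      1 / 2 * ∑' i, ‖flow (systemMode a γ α i.1) t (modeMap b ha U i)‖ ^ 2 := by
  rw [energy, ← norm_modeMap_sq b ha, norm_sq_eq_tsum]
  congr 1
  exact tsum_congr fun i => by
    rw [modeMap_semigroup hsimple hb hA hcoer hcomp ha hγ hS U ht i]

theorem hasSum_energyNorm_systemOp_sq (hsimple : HasSimpleSpectrum A)
    (hb : ∀ i, b i ∈ eigenspace A (i.1 : ℂ)) (hA : IsSelfAdjoint A) (hcoer : IsCoercive A)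
    (hcomp : HasCompactResolvent A) (ha : 0 < a) (U : (systemOp A a γ α).domain) :
    HasSum (fun i => ‖systemMode a γ α i.1 (modeMap b ha U i)‖ ^ 2)
      (energyNorm A a (systemOp A a γ α U) ^ 2) := by
  rw [← norm_modeMap b ha, norm_sq_eq_tsum]
  refine (summable_norm_sq (modeMap b ha (systemOp A a γ α U))).hasSum.congr_fun fun i => ?_
  rw [modeMap_systemOp hsimple hb hA hcoer hcomp ha]

theorem energyDecaysAtRate_decayExponent (hsimple : HasSimpleSpectrum A)
    (hb : ∀ i, b i ∈ eigenspace A (i.1 : ℂ)) (hA : IsSelfAdjoint A) (hcoer : IsCoercive A)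
    (hcomp : HasCompactResolvent A) (ha : 0 < a) (hα : α ≠ 0)
    (haγ : (a = 1 ∧ γ < 0) ∨ (a ≠ 1 ∧ γ ≤ 0))
    {S : ℝ → EnergySpace A →ₗ[ℂ] EnergySpace A} (hS : IsSystemSemigroup A a γ α S) :
    EnergyDecaysAtRate A a γ α S (decayExponent a γ) := by
  have hγ : γ ≤ 0 := by rcases haγ with h | h <;> linarith [h.2]
  obtain ⟨c, hc, hci⟩ := exists_le_eigenIndex hcoer
  obtain ⟨C, hC, hdecay⟩ := exists_systemMode_decay hc ha hα haγ
  refine ⟨C, hC, fun U t ht => ?_⟩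
  have hsum := (hasSum_energyNorm_systemOp_sq hsimple hb hA hcoer hcomp ha U).mul_left
    (C / t ^ decayExponent a γ)
  have hle := fun i : EigenIndex A => hdecay i.1 (hci i) t ht (modeMap b ha U i)
  have h1 := (hsum.summable.of_nonneg_of_le (fun _ => by positivity) hle).tsum_le_tsum hle
    hsum.summable
  rw [hsum.tsum_eq] at h1
  rw [energy_eq_tsum hsimple hb hA hcoer hcomp ha hγ hS U ht.le]
  have h2 : 0 ≤ C / t ^ decayExponent a γ * energyNorm A a (systemOp A a γ α U) ^ 2 := by
    positivity
  linarith

theorem not_energyDecaysAtRate (hH : ¬ FiniteDimensional ℂ H) (hsimple : HasSimpleSpectrum A)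
    (hb : ∀ i, b i ∈ eigenspace A (i.1 : ℂ)) (hA : IsSelfAdjoint A) (hcoer : IsCoercive A)
    (hcomp : HasCompactResolvent A) (ha : 0 < a) (hα : α ≠ 0)
    (haγ : (a = 1 ∧ γ < 0) ∨ (a ≠ 1 ∧ γ ≤ 0))
    {S : ℝ → EnergySpace A →ₗ[ℂ] EnergySpace A} (hS : IsSystemSemigroup A a γ α S)
    {ε : ℝ} (hε : 0 < ε) : ¬ EnergyDecaysAtRate A a γ α S (decayExponent a γ + ε) := by
  classical
  have hγ : γ ≤ 0 := by rcases haγ with h | h <;> linarith [h.2]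
  rintro ⟨C, hC, hdecay⟩
  obtain ⟨c, hc, hci⟩ := exists_le_eigenIndex hcoer
  obtain ⟨L, hL⟩ := exists_le_of_systemMode_decay hc ha hα haγ hε (C := 2 * C) (by positivity)
  obtain ⟨i, hi⟩ := exists_eigenIndex_gt hH hA hcoer hcomp hb L
  refine absurd (hL i.1 (hci i) fun t ht x => ?_) (not_le.2 hi)
  -- the decay is tested on the states with components in the mode `i` only
  let X : lp (fun _ : EigenIndex A => ModeSpace) 2 := lp.single 2 i x
  have hsingle : ∀ f : EigenIndex A → ModeSpace →L[ℂ] ModeSpace,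
      ∑' j, ‖f j (X j)‖ ^ 2 = ‖f i x‖ ^ 2 := by
    intro f
    have hXi : X i = x := lp.single_apply_self (E := fun _ : EigenIndex A => ModeSpace) 2 i x
    have hXj : ∀ j, j ≠ i → X j = 0 := fun j hj =>
      lp.single_apply_ne (E := fun _ : EigenIndex A => ModeSpace) 2 i x hj
    rw [tsum_eq_single i fun j hj => by simp [hXj j hj], hXi]
  obtain ⟨U, hU⟩ := modeMap_surjective hsimple hb ha hcoer X
  obtain ⟨W, hW⟩ := modeMap_surjective hsimple hb ha hcoer
    (lp.single 2 i (systemMode a γ α i.1 x))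
  obtain ⟨hdom, -⟩ := (systemOp_graph_iff hsimple hb hA hcoer hcomp ha hγ U W).2 fun j => by
    rw [hU, hW]
    by_cases hj : j = i
    · subst hj
      rw [lp.single_apply_self, lp.single_apply_self]
    · rw [lp.single_apply_ne 2 i _ hj, lp.single_apply_ne 2 i _ hj, map_zero]
  have h := hdecay ⟨U, hdom⟩ t ht
  rw [energy_eq_tsum hsimple hb hA hcoer hcomp ha hγ hS ⟨U, hdom⟩ ht.le,
    ← (hasSum_energyNorm_systemOp_sq hsimple hb hA hcoer hcomp ha ⟨U, hdom⟩).tsum_eq, hU,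
    hsingle fun j => systemMode a γ α j.1, hsingle fun j => flow (systemMode a γ α j.1) t] at h
  rw [mul_div_assoc, mul_assoc]
  linarith

end System

end CoupledSystem

theorem mainTheorem2 {H : Type*} [NormedAddCommGroup H] [InnerProductSpace ℂ H] [CompleteSpace H]
    [TopologicalSpace.SeparableSpace H] (hH : ¬ FiniteDimensional ℂ H)
    (A : H →ₗ.[ℂ] H) (hA : IsSelfAdjoint A) (hcoer : CoupledSystem.IsCoercive A)
    (hcomp : CoupledSystem.HasCompactResolvent A) (hsimple : CoupledSystem.HasSimpleSpectrum A)
    (a γ α : ℝ) (ha : 0 < a) (hα : α ≠ 0) (haγ : (a = 1 ∧ γ < 0) ∨ (a ≠ 1 ∧ γ ≤ 0)) :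
    (∃ S : ℝ → CoupledSystem.EnergySpace A →ₗ[ℂ] CoupledSystem.EnergySpace A,
      CoupledSystem.IsSystemSemigroup A a γ α S) ∧
    ∀ S : ℝ → CoupledSystem.EnergySpace A →ₗ[ℂ] CoupledSystem.EnergySpace A,
      CoupledSystem.IsSystemSemigroup A a γ α S →
        CoupledSystem.EnergyDecaysAtRate A a γ α S (CoupledSystem.decayExponent a γ) ∧
        ∀ ε : ℝ, 0 < ε →
          ¬ CoupledSystem.EnergyDecaysAtRate A a γ α S (CoupledSystem.decayExponent a γ + ε) := by
  have hγ : γ ≤ 0 := by rcases haγ with h | h <;> linarith [h.2]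
  obtain ⟨b, hb⟩ := CoupledSystem.exists_eigenbasis hA hcoer hcomp hsimple
  exact ⟨CoupledSystem.exists_isSystemSemigroup hsimple hb hA hcoer hcomp ha hγ α, fun S hS =>
    ⟨CoupledSystem.energyDecaysAtRate_decayExponent hsimple hb hA hcoer hcomp ha hα haγ hS,
      fun ε hε =>
        CoupledSystem.not_energyDecaysAtRate hH hsimple hb hA hcoer hcomp ha hα haγ hS hε⟩⟩
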